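/- **Theorem (equivalence of momentum and standard stochastic gradient methods, general costs, diagonal step-size matrices).** *Setting.* Let $J(w)=\mathbb{E}\,Q(w;\boldsymbol\theta)$, $w\in\mathbb{R}^M$, where the expectation converges for every $w$ and $Q(\cdot\,;\theta)$ is differentiable with jointly measurable gradient $\nabla_wQ(w;\theta)$. Let $w^o$ be the minimizer of $J$, and let $\boldsymbol\theta_{-1},\boldsymbol\theta_0,\boldsymbol\theta_1,\dots$ be random samples, each with the law of $\boldsymbol\theta$. Let $D_m$ be a diagonal matrix with positive diagonal entries and let $B_1,B_2$ be diagonal matrices with $$0\le B_k<I\ (k=1,2),\qquad B_1B_2=0,\qquad B:=B_1+B_2\le(1-\epsilon)I$$ for a constant $\epsilon>0$. Put $D=(I-B)^{-1}D_m=\mathrm{diag}\{\mu_1,\dots,\mu_M\}$ and $\mu_{\max}=\max_j\mu_j$. For $i\ge0$ consider $$\boldsymbol x_i=\boldsymbol x_{i-1}-D\,\nabla_wQ(\boldsymbol x_{i-1};\boldsymbol\theta_i),$$ $$\boldsymbol\psi_{i-1}=\boldsymbol w_{i-1}+B_1(\boldsymbol w_{i-1}-\boldsymbol w_{i-2}),\qquad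 \boldsymbol w_i=\boldsymbol\psi_{i-1}-D_m\nabla_wQ(\boldsymbol\psi_{i-1};\boldsymbol\theta_i)+B_2(\boldsymbol\psi_{i-1}-\boldsymbol\psi_{i-2}),$$ started from $\boldsymbol\psi_{-2}=\boldsymbol w_{-2}=\boldsymbol x_{-1}$ and $\boldsymbol w_{-1}=\boldsymbol w_{-2}-D_m\nabla_wQ(\boldsymbol w_{-2};\boldsymbol\theta_{-1})$, where $\boldsymbol w_{-2}$ and $\nabla_wQ(\boldsymbol w_{-2};\boldsymbol\theta_{-1})$ have finite fourth moments. Write $\widetilde{\boldsymbol w}_i=w^o-\boldsymbol w_i$, $\widetilde{\boldsymbol x}_i=w^o-\boldsymbol x_i$, $\boldsymbol s_i(w)=\nabla_wQ(w;\boldsymbol\theta_i)-\nabla J(w)$, and let $\boldsymbol{\mathcal F}_{i}$ be the $\sigma$-algebra generated by $\boldsymbol w_j$ $(-2\le j\le i)$ and $\boldsymbol x_j$ $(-1\le j\le i)$. *Assumptions.* 1. $J$ is twice differentiable and $\nu I\le\nabla^2J(w)\le\delta I$ for all $w$, with $0<\nu\le\delta$. 2. For all $i\ge0$ and every $\boldsymbol{\mathcal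 F}_{i-1}$-measurable random vector $\boldsymbol v$ with finite fourth moment, $\boldsymbol s_i(\boldsymbol v)$ has finite fourth moment and, almost surely, $\mathbb{E}[\boldsymbol s_i(\boldsymbol v)\mid\boldsymbol{\mathcal F}_{i-1}]=0$ and $\mathbb{E}[\|\boldsymbol s_i(\boldsymbol v)\|^4\mid\boldsymbol{\mathcal F}_{i-1}]\le\gamma_4^4\|w^o-\boldsymbol v\|^4+\sigma_{s,4}^4$. 3. For all $i\ge0$, almost surely, $\mathbb{E}[\|\boldsymbol s_i(\boldsymbol\psi_{i-1})-\boldsymbol s_i(\boldsymbol x_{i-1})\|^2\mid\boldsymbol{\mathcal F}_{i-1}]\le\xi_1\|\boldsymbol\psi_{i-1}-\boldsymbol x_{i-1}\|^2$ and $\mathbb{E}[\|\boldsymbol s_i(\boldsymbol\psi_{i-1})-\boldsymbol s_i(\boldsymbol x_{i-1})\|^4\mid\boldsymbol{\mathcal F}_{i-1}]\le\xi_2\|\boldsymbol\psi_{i-1}-\boldsymbol x_{i-1}\|^4$. 4. $\|\nabla^2J(w_1)-\nabla^2J(w_2)\|\le\kappa\|w_1-w_2\|$ for all $w_1,w_2$.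 *Conclusion.* For sufficiently small $\mu_{\max}$, $$\mathbb{E}\|\widetilde{\boldsymbol w}_i-\widetilde{\boldsymbol x}_i\|^2=O(\mu_{\max}^{3/2})\quad\text{for all } i=0,1,2,\dots,\qquad \limsup_{i\to\infty}\mathbb{E}\|\widetilde{\boldsymbol w}_i-\widetilde{\boldsymbol x}_i\|^2=O(\mu_{\max}^2).$$ Precisely: there are $\mu_0>0$ and $C_\infty$ depending only on $M,\nu,\delta,\gamma_4,\sigma_{s,4},\xi_1,\xi_2,\kappa,\epsilon$, and for every $m$ a constant $C$ depending only on these and on $m$, such that whenever $\mathbb{E}\|\widetilde{\boldsymbol w}_{-2}\|^4\le m$, $\mathbb{E}\|\nabla_wQ(\boldsymbol w_{-2};\boldsymbol\theta_{-1})\|^4\le m$ and $\mu_{\max}\le\mu_0$, the expectations below are finite, $\mathbb{E}\|\widetilde{\boldsymbol w}_i-\widetilde{\boldsymbol x}_i\|^2\le C\mu_{\max}^{3/2}$ for every $i\ge0$, and $\limsup_{i\to\infty}\mathbb{E}\|\widetilde{\boldsymbol w}_i-\widetilde{\boldsymbol x}_i\|^2\le C_\infty\mu_{\max}^2$. -/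

import Mathlib

open MeasureTheory Filter
open scoped ENNReal Gradient

noncomputable section

namespace MomentumSGD

/-- The parameter space `ℝ^M` with its Euclidean norm. -/
abbrev Vec (M : ℕ) : Type := EuclideanSpace ℝ (Fin M)

/-- The product `diag(d) v` of a diagonal matrix, given by its diagonal `d`, with a vector. -/
def diagMul {M : ℕ} (d : Fin M → ℝ) (v : Vec M) : Vec M :=
  WithLp.toLp 2 (fun j => d j * v j)

/-- The largest entry `max_j d j` of a diagonal matrix (the index set is finite). -/
def maxEntry {M : ℕ} (d : Fin M → ℝ) : ℝ := ⨆ j, d j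

/-- The stochastic gradient `∇_w Q(w; ϑ)`. -/
def gradQ {M : ℕ} {Θ : Type*} (Q : Vec M → Θ → ℝ) (w : Vec M) (ϑ : Θ) : Vec M :=
  ∇ (fun v => Q v ϑ) w

/-- The risk `J(w) = E_θ Q(w; θ)`, where `θ` has law `P`. -/
def risk {M : ℕ} {Θ : Type*} [MeasurableSpace Θ] (Q : Vec M → Θ → ℝ) (P : Measure Θ) :
    Vec M → ℝ :=
  fun w => ∫ ϑ, Q w ϑ ∂P

/-- The Hessian `∇² J(w)`, as the derivative of the gradient field. -/
def hessian {M : ℕ} (J : Vec M → ℝ) (w : Vec M) : Vec M →L[ℝ] Vec M :=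
  fderiv ℝ (∇ J) w

/-- Regularity of the loss that is needed for the risk and the stochastic gradients to be
meaningful: the risk is a convergent integral, the loss is differentiable in `w`, and its gradient
is jointly measurable. -/
structure IsLoss {M : ℕ} {Θ : Type*} [MeasurableSpace Θ] (Q : Vec M → Θ → ℝ)
    (P : Measure Θ) : Prop where
  integrable : ∀ w, Integrable (Q w) P
  differentiable : ∀ ϑ, Differentiable ℝ (fun w => Q w ϑ)
  measurable_grad : Measurable (fun p : Vec M × Θ => gradQ Q p.1 p.2)

/-- The risk is twice differentiable and `ν I ≤ ∇² J(w) ≤ δ I` for every `w`. -/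
structure RiskConditions {M : ℕ} (J : Vec M → ℝ) (ν δ : ℝ) : Prop where
  differentiable : Differentiable ℝ J
  differentiable_grad : Differentiable ℝ (∇ J)
  lower : ∀ w v, ν * ‖v‖ ^ 2 ≤ inner ℝ v (hessian J w v)
  upper : ∀ w v, inner ℝ v (hessian J w v) ≤ δ * ‖v‖ ^ 2

/-- The Hessian is Lipschitz with constant `κ`, in the operator norm. -/
def HessianLipschitz {M : ℕ} (J : Vec M → ℝ) (κ : ℝ) : Prop :=
  ∀ w₁ w₂, ‖hessian J w₁ - hessian J w₂‖ ≤ κ * ‖w₁ - w₂‖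

/-- The diagonal momentum matrices satisfy `0 ≤ B_k < I`, `B₁ B₂ = 0` and
`B = B₁ + B₂ ≤ (1 - ε) I`. -/
structure MomentumMatrices {M : ℕ} (β₁ β₂ : Fin M → ℝ) (ε : ℝ) : Prop where
  nonneg₁ : ∀ j, 0 ≤ β₁ j
  lt_one₁ : ∀ j, β₁ j < 1
  nonneg₂ : ∀ j, 0 ≤ β₂ j
  lt_one₂ : ∀ j, β₂ j < 1
  mul_eq_zero : ∀ j, β₁ j * β₂ j = 0
  add_le : ∀ j, β₁ j + β₂ j ≤ 1 - ε

section Iterates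

variable {M : ℕ} {Ω Θ : Type*}

/-- The standard recursion `x_i = x_{i-1} - D ∇Q(x_{i-1}; θ_i)`, `i ≥ 0`, with `D = diag(μ)`;
the initial state is `x_{-1}`. -/
def IsSGD (Q : Vec M → Θ → ℝ) (θ : ℤ → Ω → Θ) (μ : Fin M → ℝ) (x : ℤ → Ω → Vec M) : Prop :=
  ∀ i : ℤ, 0 ≤ i → ∀ ω, x i ω = x (i - 1) ω - diagMul μ (gradQ Q (x (i - 1) ω) (θ i ω))

/-- The momentum recursion with `D_m = diag(μm)`, `B₁ = diag(β₁)`, `B₂ = diag(β₂)`; the initial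
state is `w_{-2} = ψ_{-2}`. -/
structure IsMomentumSGD (Q : Vec M → Θ → ℝ) (θ : ℤ → Ω → Θ) (μm β₁ β₂ : Fin M → ℝ)
    (w ψ : ℤ → Ω → Vec M) : Prop where
  init_psi : ∀ ω, ψ (-2) ω = w (-2) ω
  init_w : ∀ ω, w (-1) ω = w (-2) ω - diagMul μm (gradQ Q (w (-2) ω) (θ (-1) ω))
  step_psi : ∀ i : ℤ, 0 ≤ i → ∀ ω,
    ψ (i - 1) ω = w (i - 1) ω + diagMul β₁ (w (i - 1) ω - w (i - 2) ω)
  step_w : ∀ i : ℤ, 0 ≤ i → ∀ ω,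
    w i ω = ψ (i - 1) ω - diagMul μm (gradQ Q (ψ (i - 1) ω) (θ i ω))
      + diagMul β₂ (ψ (i - 1) ω - ψ (i - 2) ω)

/-- The past `F_i`: the σ-algebra generated by the iterates of the two recursions up to time `i`
(the momentum recursion starts at time `-2`, the standard one at time `-1`). -/
@[reducible] def history (w x : ℤ → Ω → Vec M) (i : ℤ) : MeasurableSpace Ω :=
  (⨆ j ∈ Set.Icc (-2 : ℤ) i, MeasurableSpace.comap (w j) inferInstance) ⊔
    (⨆ j ∈ Set.Icc (-1 : ℤ) i, MeasurableSpace.comap (x j) inferInstance)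

/-- The gradient noise `s_i(v) = ∇Q(v; θ_i) - ∇J(v)` at a random vector `v`. -/
def gradNoise [MeasurableSpace Θ] (Q : Vec M → Θ → ℝ) (P : Measure Θ) (θ : ℤ → Ω → Θ) (i : ℤ)
    (v : Ω → Vec M) (ω : Ω) : Vec M :=
  gradQ Q (v ω) (θ i ω) - ∇ (risk Q P) (v ω)

/-- First and fourth conditional moments of the gradient noise at `F_{i-1}`-measurable points.
The points are taken in `L⁴`, and the noise is required to be in `L⁴` there, so that the
conditional expectations are the genuine ones. -/
def NoiseMoments [MeasurableSpace Ω] [MeasurableSpace Θ] (ℙ : Measure Ω) (P : Measure Θ)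
    (Q : Vec M → Θ → ℝ) (θ : ℤ → Ω → Θ) (wo : Vec M) (w x : ℤ → Ω → Vec M) (γ σ : ℝ) : Prop :=
  ∀ i : ℤ, 0 ≤ i → ∀ v : Ω → Vec M, Measurable[history w x (i - 1)] v → MemLp v 4 ℙ →
    MemLp (gradNoise Q P θ i v) 4 ℙ ∧
    ℙ[gradNoise Q P θ i v | history w x (i - 1)] =ᵐ[ℙ] 0 ∧
    ℙ[fun ω => ‖gradNoise Q P θ i v ω‖ ^ 4 | history w x (i - 1)]
      ≤ᵐ[ℙ] fun ω => γ ^ 4 * ‖wo - v ω‖ ^ 4 + σ ^ 4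

/-- Conditional mean-square and mean-fourth Lipschitz conditions on the gradient noise along the
iterates `ψ_{i-1}` and `x_{i-1}`. -/
def NoiseLipschitz [MeasurableSpace Ω] [MeasurableSpace Θ] (ℙ : Measure Ω) (P : Measure Θ)
    (Q : Vec M → Θ → ℝ) (θ : ℤ → Ω → Θ) (w ψ x : ℤ → Ω → Vec M) (ξ₁ ξ₂ : ℝ) : Prop :=
  ∀ i : ℤ, 0 ≤ i →
    ℙ[fun ω => ‖gradNoise Q P θ i (ψ (i - 1)) ω - gradNoise Q P θ i (x (i - 1)) ω‖ ^ 2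
        | history w x (i - 1)]
      ≤ᵐ[ℙ] (fun ω => ξ₁ * ‖ψ (i - 1) ω - x (i - 1) ω‖ ^ 2) ∧
    ℙ[fun ω => ‖gradNoise Q P θ i (ψ (i - 1)) ω - gradNoise Q P θ i (x (i - 1)) ω‖ ^ 4
        | history w x (i - 1)]
      ≤ᵐ[ℙ] (fun ω => ξ₂ * ‖ψ (i - 1) ω - x (i - 1) ω‖ ^ 4)

/-- The initial state is measurable and in `L⁴`, the first stochastic gradient
`∇Q(w_{-2}; θ_{-1})` is in `L⁴`, and the fourth moments of the initial error and of that gradient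
are at most `m`. -/
structure InitialMoments [MeasurableSpace Ω] (ℙ : Measure Ω)
    (Q : Vec M → Θ → ℝ) (θ : ℤ → Ω → Θ) (wo : Vec M) (w : ℤ → Ω → Vec M) (m : ℝ) : Prop where
  measurable : Measurable (w (-2))
  memLp : MemLp (w (-2)) 4 ℙ
  memLp_grad : MemLp (fun ω => gradQ Q (w (-2) ω) (θ (-1) ω)) 4 ℙ
  bound : ∫ ω, ‖wo - w (-2) ω‖ ^ 4 ∂ℙ ≤ m
  bound_grad : ∫ ω, ‖gradQ Q (w (-2) ω) (θ (-1) ω)‖ ^ 4 ∂ℙ ≤ m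

end Iterates

end MomentumSGD

end

noncomputable section

namespace MomentumSGD

/-! ### Scalar and componentwise contractions -/

/-! Since `B₁ B₂ = 0`, `B₂ ψ` equals `B₂ w`, so both kinds of momentum merge into one recursion for
the increments `u`, namely `u_{n+1} = B u_n - D_m G_n` (`Coupling.u_succ`). The average `V = w + (I
- B)⁻¹ B u` then obeys `V_{n+1} = V_n - D G_n` (`Coupling.V_succ`): it is a standard stochastic
gradient iteration whose gradients are evaluated at `V + a`, with `a` a bounded diagonal multiple of
`u`.

Because `B ≤ (1 - ε) I`, the increments forget their past at a rate independent of the step-sizes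
and are driven by `D_m G`. Hence `E‖u‖² = O(L²)`, with `L` the largest step-size, once the error of
`V` is bounded in mean square. The difference `z = V - x` starts at size `O(L)`. Its drift is
strongly monotone up to the perturbation `a`, and its noise is a difference of gradient noises,
controlled by `z + a` with no additive constant. So `E‖z‖² = O(L²)`, and the same follows for `w -
x`, which is `z` minus a bounded multiple of `u`. This order holds at all times and implies the
uniform rate `L^(3/2)`; after the initial data are forgotten the constant no longer depends on them.

The difficulty is that the entries of `D` may have very different sizes, while no constant may
depend on their ratios. The natural energy `∑ q_j² / μ_j` decays only at the rate of the smallest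
entry. The remedy is to prove dissipation for every set of coordinates, with the other coordinates
as input (`RiskConditions.energy_step`), and to bound the coordinates one at a time, slowest first
(`Dissipative.sum_le`, `Dissipative.eventually_sum_le`). The error of `V` and the increments drive
each other, so the increments join that argument as one extra coordinate
(`MeanSquareSystem.dissipative_joint`). -/

theorem le_of_contraction {v b : ℕ → ℝ} {r B : ℝ} (hr : 0 ≤ r) (hr1 : r ≤ 1)
    (hv : ∀ i, v (i + 1) ≤ (1 - r) * v i + r * b i) (hb : ∀ i, b i ≤ B) (h0 : v 0 ≤ B) (i : ℕ) :
    v i ≤ B := by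
  induction i with
  | zero => exact h0
  | succ n ih =>
    have h1 := mul_le_mul_of_nonneg_left ih (sub_nonneg.2 hr1)
    have h2 := mul_le_mul_of_nonneg_left (hb n) hr
    linarith [hv n]

theorem eventually_le_of_contraction {v b : ℕ → ℝ} {r B η : ℝ} (hr : 0 < r) (hr1 : r ≤ 1)
    (hv : ∀ i, v (i + 1) ≤ (1 - r) * v i + r * b i) (hb : ∀ᶠ i in atTop, b i ≤ B) (hη : 0 < η) :
    ∀ᶠ i in atTop, v i ≤ B + η := by
  obtain ⟨N, hN⟩ := eventually_atTop.1 hb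
  have key : ∀ k, v (N + k) - B ≤ (1 - r) ^ k * (v N - B) := by
    intro k
    induction k with
    | zero => simp
    | succ n ih =>
      have h1 := mul_le_mul_of_nonneg_left ih (sub_nonneg.2 hr1)
      have h2 := mul_le_mul_of_nonneg_left (hN (N + n) (by omega)) hr.le
      have h3 := hv (N + n)
      rw [pow_succ']
      have e : N + (n + 1) = N + n + 1 := by ring
      rw [e]
      nlinarith
  have lim : Tendsto (fun k : ℕ => (1 - r) ^ k * (v N - B)) atTop (nhds 0) := by
    simpa using (tendsto_pow_atTop_nhds_zero_of_lt_one (sub_nonneg.2 hr1)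
      (by linarith)).mul_const (v N - B)
  obtain ⟨k₀, hk⟩ := eventually_atTop.1 (lim.eventually (gt_mem_nhds hη))
  refine eventually_atTop.2 ⟨N + k₀, fun i hi => ?_⟩
  obtain ⟨k, rfl⟩ := Nat.exists_eq_add_of_le (show N ≤ i by omega)
  linarith [key k, hk k (by omega)]

/-- A family of nonnegative sequences which, for every set `S` of components, dissipates the energy
`∑_{j ∈ S} f_j / μ_j` up to the other components and an input `h`. -/
structure Dissipative {ι : Type*} [Fintype ι] [DecidableEq ι] (f : ι → ℕ → ℝ) (h : ℕ → ℝ)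
    (μ : ι → ℝ) (a c : ℝ) : Prop where
  nonneg : ∀ j i, 0 ≤ f j i
  pos : ∀ j, 0 < μ j
  le_one : ∀ j, a * μ j ≤ 1
  step : ∀ (S : Finset ι) i, ∑ j ∈ S, f j (i + 1) / μ j ≤
    ∑ j ∈ S, f j i / μ j - a * ∑ j ∈ S, f j i + (c * ∑ j ∈ Sᶜ, f j i + h i)

/-! ### Bounds for dissipative families, uniform in the ratios of the step-sizes -/

namespace Dissipative

variable {ι : Type*} [Fintype ι] [DecidableEq ι] {f : ι → ℕ → ℝ} {h : ℕ → ℝ} {μ : ι → ℝ}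
  {a c : ℝ}

/-- Scaling the energy by the smallest step-size `μ k` of `S` makes it at most the plain sum over
`S`, so the dissipation contracts it at rate `a * μ k`. The input carries the same factor `μ k`,
hence the resulting bound does not depend on `μ k`. -/
theorem contraction (hf : Dissipative f h μ a c) (ha : 0 < a) {S : Finset ι} {k : ι}
    (hmin : ∀ j ∈ S, μ k ≤ μ j) (i : ℕ) :
    μ k * ∑ j ∈ S, f j (i + 1) / μ j ≤ (1 - a * μ k) * (μ k * ∑ j ∈ S, f j i / μ j)
      + a * μ k * ((c * ∑ j ∈ Sᶜ, f j i + h i) / a) := by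
  have h1 : μ k * ∑ j ∈ S, f j i / μ j ≤ ∑ j ∈ S, f j i := by
    rw [Finset.mul_sum]
    refine Finset.sum_le_sum fun j hj => ?_
    rw [mul_div_assoc', div_le_iff₀ (hf.pos j), mul_comm]
    exact mul_le_mul_of_nonneg_left (hmin j hj) (hf.nonneg j i)
  have h2 := mul_le_mul_of_nonneg_left (hf.step S i) (hf.pos k).le
  have h3 : a * μ k * ((c * ∑ j ∈ Sᶜ, f j i + h i) / a) = μ k * (c * ∑ j ∈ Sᶜ, f j i + h i) := by
    field_simp
  have h4 := mul_le_mul_of_nonneg_left h1 (mul_pos ha (hf.pos k)).le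
  rw [h3]
  nlinarith

theorem component_le (hf : Dissipative f h μ a c) {S : Finset ι} {k : ι} (hk : k ∈ S) (i : ℕ) :
    f k i ≤ μ k * ∑ j ∈ S, f j i / μ j := by
  have h1 : f k i / μ k ≤ ∑ j ∈ S, f j i / μ j :=
    Finset.single_le_sum (f := fun j => f j i / μ j)
      (fun j _ => div_nonneg (hf.nonneg j i) (hf.pos j).le) hk
  have := mul_le_mul_of_nonneg_left h1 (hf.pos k).le
  rwa [mul_div_cancel₀ _ (hf.pos k).ne'] at this

theorem initial_le (hf : Dissipative f h μ a c) {S : Finset ι} {k : ι}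
    (hmin : ∀ j ∈ S, μ k ≤ μ j) (i : ℕ) : μ k * ∑ j ∈ S, f j i / μ j ≤ ∑ j, f j i := by
  have h1 : μ k * ∑ j ∈ S, f j i / μ j ≤ ∑ j ∈ S, f j i := by
    rw [Finset.mul_sum]
    refine Finset.sum_le_sum fun j hj => ?_
    rw [mul_div_assoc', div_le_iff₀ (hf.pos j), mul_comm]
    exact mul_le_mul_of_nonneg_left (hmin j hj) (hf.nonneg j i)
  exact h1.trans (Finset.sum_le_univ_sum_of_nonneg fun j => hf.nonneg j i)

theorem sum_compl_erase {S : Finset ι} {k : ι} (hk : k ∈ S) (g : ι → ℝ) :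
    ∑ j ∈ (S.erase k)ᶜ, g j = g k + ∑ j ∈ Sᶜ, g j := by
  rw [Finset.compl_erase, Finset.sum_insert (by simpa using hk)]

/-- Induction on the set `S` of coordinates not yet bounded. The scaled energy of `S` controls its
slowest coordinate without loss, but the faster ones only up to a ratio of step-sizes. Therefore
only the slowest is retained: it moves to the complement, where it acts as a bounded input for the
rest. -/
theorem sum_le_aux (hf : Dissipative f h μ a c) (ha : 0 < a) (hc : 0 ≤ c) {H : ℝ}
    (hh : ∀ i, h i ≤ H) : ∀ (S : Finset ι) (G : ℝ), 0 ≤ G → H ≤ a * G →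
      (∀ i, ∑ j ∈ Sᶜ, f j i ≤ G) → ∀ i,
      ∑ j, f j i ≤ (3 + c / a) ^ S.card * (∑ j, f j 0 + G) := by
  intro S
  induction S using Finset.strongInduction with
  | H S ih =>
  intro G hG hHG hS i
  have hf0 : 0 ≤ ∑ j, f j 0 := Finset.sum_nonneg fun j _ => hf.nonneg j 0
  have hca : 0 ≤ c / a := by positivity
  rcases S.eq_empty_or_nonempty with rfl | hne
  · have := hS i
    simp only [Finset.compl_empty] at this
    simpa using this.trans (by linarith)
  obtain ⟨k, hk, hmin⟩ := S.exists_min_image μ hne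
  have hGc : 0 ≤ (c / a + 1) * G := by positivity
  have hB : ∀ i, (c * ∑ j ∈ Sᶜ, f j i + h i) / a ≤ ∑ j, f j 0 + (c / a + 1) * G := fun i => by
    rw [div_le_iff₀ ha]
    have h1 := mul_le_mul_of_nonneg_left (hS i) hc
    have h2 : (∑ j, f j 0 + (c / a + 1) * G) * a = a * ∑ j, f j 0 + c * G + a * G := by
      field_simp
      ring
    rw [h2]
    nlinarith [hh i]
  have hV : ∀ i, μ k * ∑ j ∈ S, f j i / μ j ≤ ∑ j, f j 0 + (c / a + 1) * G :=
    le_of_contraction (mul_pos ha (hf.pos k)).le (hf.le_one k) (hf.contraction ha hmin) hB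
      ((hf.initial_le hmin 0).trans (by linarith))
  have hbound : ∀ i, f k i ≤ ∑ j, f j 0 + (c / a + 1) * G := fun i =>
    (hf.component_le hk i).trans (hV i)
  -- The new complement bound adds the bound on `f k` to the old `G`; each removal then costs at
  -- most a factor `3 + c / a`.
  have := ih (S.erase k) (Finset.erase_ssubset hk) (∑ j, f j 0 + (c / a + 2) * G) (by positivity)
    (hHG.trans (mul_le_mul_of_nonneg_left (by nlinarith) ha.le))
    (fun i => by
      rw [sum_compl_erase hk]
      linarith [hbound i, hS i]) i
  have hcard : S.card = (S.erase k).card + 1 := (Finset.card_erase_add_one hk).symm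
  rw [hcard, pow_succ, mul_assoc]
  refine this.trans (mul_le_mul_of_nonneg_left ?_ (by positivity))
  nlinarith

theorem sum_le (hf : Dissipative f h μ a c) (ha : 0 < a) (hc : 0 ≤ c) {H : ℝ} (hH : 0 ≤ H)
    (hh : ∀ i, h i ≤ H) (i : ℕ) :
    ∑ j, f j i ≤ (3 + c / a) ^ Fintype.card ι * (∑ j, f j 0 + H / a) := by
  refine hf.sum_le_aux ha hc hh Finset.univ (H / a) (by positivity) ?_ (fun i => ?_) i
  · rw [mul_div_cancel₀ _ ha.ne']
  · simpa using by positivity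

theorem eventually_sum_le_aux (hf : Dissipative f h μ a c) (ha : 0 < a) (hc : 0 ≤ c) {H : ℝ}
    (hh : ∀ᶠ i in atTop, h i ≤ H) : ∀ (S : Finset ι) (G : ℝ), 0 < G → H ≤ a * G →
      (∀ᶠ i in atTop, ∑ j ∈ Sᶜ, f j i ≤ G) → ∀ᶠ i in atTop,
      ∑ j, f j i ≤ (3 + c / a) ^ S.card * G := by
  intro S
  induction S using Finset.strongInduction with
  | H S ih =>
  intro G hG hHG hS
  have hca : 0 ≤ c / a := by positivity
  rcases S.eq_empty_or_nonempty with rfl | hne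
  · simpa using hS
  obtain ⟨k, hk, hmin⟩ := S.exists_min_image μ hne
  -- The slack of the eventual bound is taken to be `G` itself, so no initial value enters and the
  -- loss per coordinate is again `3 + c / a`.
  have hbound : ∀ᶠ i in atTop, μ k * ∑ j ∈ S, f j i / μ j ≤ (c / a + 1) * G + G :=
    eventually_le_of_contraction (mul_pos ha (hf.pos k)) (hf.le_one k)
      (hf.contraction ha hmin) (by
        filter_upwards [hS, hh] with i h3 h4
        rw [div_le_iff₀ ha]
        have h1 := mul_le_mul_of_nonneg_left h3 hc
        have h2 : (c / a + 1) * G * a = c * G + a * G := by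
          field_simp
        rw [h2]
        linarith) hG
  have := ih (S.erase k) (Finset.erase_ssubset hk) ((3 + c / a) * G) (by positivity)
    (hHG.trans (mul_le_mul_of_nonneg_left (by nlinarith) ha.le))
    (by
      filter_upwards [hS, hbound] with i h3 h4
      rw [sum_compl_erase hk]
      linarith [hf.component_le hk i])
  have hcard : S.card = (S.erase k).card + 1 := (Finset.card_erase_add_one hk).symm
  rw [hcard, pow_succ, mul_assoc]
  exact this

theorem eventually_sum_le (hf : Dissipative f h μ a c) (ha : 0 < a) (hc : 0 ≤ c) {H : ℝ}
    (hH : 0 < H) (hh : ∀ᶠ i in atTop, h i ≤ H) :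
    ∀ᶠ i in atTop, ∑ j, f j i ≤ (3 + c / a) ^ Fintype.card ι * (H / a) := by
  refine hf.eventually_sum_le_aux ha hc hh Finset.univ (H / a) (by positivity) ?_ ?_
  · rw [mul_div_cancel₀ _ ha.ne']
  · exact .of_forall fun i => by simpa using by positivity

end Dissipative

/-! ### Gradients of strongly convex smooth functions -/

section Gradient

variable {M : ℕ} {J : Vec M → ℝ} {ν δ : ℝ}

theorem RiskConditions.inner_hessian_comm (hJ : RiskConditions J ν δ) (w v v' : Vec M) :
    inner ℝ v (hessian J w v') = inner ℝ v' (hessian J w v) := by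
  let T := InnerProductSpace.toDualMap ℝ (Vec M)
  have h1 : ∀ y, HasFDerivAt J (T (∇ J y)) y := fun y =>
    (hJ.differentiable y).hasGradientAt.hasFDerivAt
  have h2 : HasFDerivAt (fun y => T.toContinuousLinearMap (∇ J y))
      (T.toContinuousLinearMap.comp (hessian J w)) w :=
    T.toContinuousLinearMap.hasFDerivAt.comp w (hJ.differentiable_grad w).hasFDerivAt
  have h3 := second_derivative_symmetric (f' := fun y => T.toContinuousLinearMap (∇ J y))
    (fun y => h1 y) h2 v' v
  have h4 : inner ℝ (hessian J w v') v = inner ℝ (hessian J w v) v' := h3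
  rw [real_inner_comm, h4, real_inner_comm]

/-- The Hessian is symmetric and positive semidefinite, so polarization turns the upper bound on its
quadratic form into a bound on the bilinear form, which is then tested on `v` and the normalized
image of `v`. -/
theorem RiskConditions.norm_hessian_le (hJ : RiskConditions J ν δ) (hν : 0 ≤ ν) (hδ : 0 ≤ δ)
    (w : Vec M) : ‖hessian J w‖ ≤ δ := by
  have key : ∀ v v' : Vec M, 4 * inner ℝ v (hessian J w v') ≤ δ * ‖v + v'‖ ^ 2 := by
    intro v v'
    have h1 := hJ.upper w (v + v')
    have h2 := (mul_nonneg hν (sq_nonneg _)).trans (hJ.lower w (v - v'))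
    have h3 := hJ.inner_hessian_comm w v v'
    simp only [map_add, map_sub, inner_add_left, inner_add_right, inner_sub_left,
      inner_sub_right] at h1 h2
    linarith
  refine ContinuousLinearMap.opNorm_le_of_unit_norm hδ fun v hv => ?_
  rcases eq_or_ne (hessian J w v) 0 with h0 | h0
  · rw [h0, norm_zero]; exact hδ
  have hn : 0 < ‖hessian J w v‖ := norm_pos_iff.2 h0
  have h1 := key (‖hessian J w v‖⁻¹ • hessian J w v) v
  have h2 : ‖‖hessian J w v‖⁻¹ • hessian J w v + v‖ ≤ 2 := by
    refine (norm_add_le _ _).trans ?_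
    rw [norm_smul, norm_inv, norm_norm, inv_mul_cancel₀ hn.ne', hv]
    norm_num
  rw [real_inner_smul_left, real_inner_self_eq_norm_sq, pow_two, inv_mul_cancel_left₀ hn.ne'] at h1
  have h3 : ‖‖hessian J w v‖⁻¹ • hessian J w v + v‖ ^ 2 ≤ 2 ^ 2 :=
    pow_le_pow_left₀ (norm_nonneg _) h2 2
  nlinarith [mul_le_mul_of_nonneg_left h3 hδ]

theorem RiskConditions.norm_gradient_sub_le (hJ : RiskConditions J ν δ) (hν : 0 ≤ ν) (hδ : 0 ≤ δ)
    (a b : Vec M) : ‖∇ J a - ∇ J b‖ ≤ δ * ‖a - b‖ :=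
  convex_univ.norm_image_sub_le_of_norm_fderiv_le (𝕜 := ℝ)
    (fun y _ => hJ.differentiable_grad y) (fun y _ => hJ.norm_hessian_le hν hδ y)
    (Set.mem_univ b) (Set.mem_univ a)

theorem RiskConditions.le_inner_gradient_sub (hJ : RiskConditions J ν δ) (a b : Vec M) :
    ν * ‖a - b‖ ^ 2 ≤ inner ℝ (a - b) (∇ J a - ∇ J b) := by
  have h : ∀ t : ℝ, HasDerivAt (fun t : ℝ => inner ℝ (a - b) (∇ J (b + t • (a - b))))
      (inner ℝ (a - b) (hessian J (b + t • (a - b)) (a - b))) t := by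
    intro t
    have h1 : HasDerivAt (fun t : ℝ => b + t • (a - b)) (a - b) t := by
      simpa using ((hasDerivAt_id t).smul_const (a - b)).const_add b
    have h2 := (hJ.differentiable_grad (b + t • (a - b))).hasFDerivAt.comp_hasDerivAt t h1
    exact (innerSL ℝ (a - b)).hasFDerivAt.comp_hasDerivAt t h2
  have := mul_sub_le_image_sub_of_le_deriv (fun t => (h t).differentiableAt)
    (C := ν * ‖a - b‖ ^ 2) (fun t => by rw [(h t).deriv]; exact hJ.lower _ _)
    (zero_le_one (α := ℝ))
  rw [inner_sub_right]
  simpa using this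

theorem gradient_eq_zero_of_minimizer {wo : Vec M} (h : ∀ v, J wo ≤ J v) : ∇ J wo = 0 := by
  have : fderiv ℝ J wo = 0 := IsLocalMin.fderiv_eq_zero (Filter.Eventually.of_forall h)
  rw [gradient, this, map_zero]

/-- The vector with the coordinates outside `S` set to zero. -/
def restrict (S : Finset (Fin M)) (q : Vec M) : Vec M :=
  diagMul (fun j => if j ∈ S then 1 else 0) q

theorem norm_sq_restrict (S : Finset (Fin M)) (q : Vec M) :
    ‖restrict S q‖ ^ 2 = ∑ j ∈ S, q j ^ 2 := by
  simp [EuclideanSpace.real_norm_sq_eq, restrict, diagMul, ite_pow, Finset.sum_ite_mem]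

theorem norm_sq_sub_restrict (S : Finset (Fin M)) (q : Vec M) :
    ‖q - restrict S q‖ ^ 2 = ∑ j ∈ Sᶜ, q j ^ 2 := by
  have h : ∀ j, (q j - (if j ∈ S then 1 else 0) * q j) ^ 2 = if j ∈ Sᶜ then q j ^ 2 else 0 := by
    intro j
    by_cases hj : j ∈ S <;> simp [hj]
  simp only [EuclideanSpace.real_norm_sq_eq, restrict, diagMul, PiLp.sub_apply, h,
    Finset.sum_ite_mem, Finset.univ_inter]

theorem inner_restrict (S : Finset (Fin M)) (q d : Vec M) :
    inner ℝ (restrict S q) d = ∑ j ∈ S, q j * d j := by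
  simp [PiLp.inner_apply, restrict, diagMul, ite_mul, Finset.sum_ite_mem, mul_comm]

theorem norm_add_sq_le (a b : Vec M) : ‖a + b‖ ^ 2 ≤ 2 * (‖a‖ ^ 2 + ‖b‖ ^ 2) := by
  have h := norm_add_le a b
  nlinarith [sq_nonneg (‖a‖ - ‖b‖), norm_nonneg (a + b)]

/-- Strong monotonicity of the gradient on a set of coordinates, up to the other coordinates and a
perturbation. -/
theorem RiskConditions.le_sum_mul_gradient_sub (hJ : RiskConditions J ν δ) (hν : 0 < ν)
    (hδ : 0 ≤ δ) (S : Finset (Fin M)) (y q a : Vec M) :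
    ν / 2 * ∑ j ∈ S, q j ^ 2 - δ ^ 2 / ν * (∑ j ∈ Sᶜ, q j ^ 2 + ‖a‖ ^ 2) ≤
      ∑ j ∈ S, q j * (∇ J (y + q + a) - ∇ J y) j := by
  rw [← inner_restrict, ← norm_sq_restrict, ← norm_sq_sub_restrict]
  set p := restrict S q
  -- Strong monotonicity is used only between `y` and `y + p`; the remaining displacement `q - p +
  -- a` is handled by the Lipschitz bound and Young's inequality, at the cost of half of `ν`.
  have h1 := hJ.le_inner_gradient_sub (y + p) y
  have h2 := hJ.norm_gradient_sub_le hν.le hδ (y + q + a) (y + p)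
  have e1 : y + p - y = p := by abel
  have e2 : y + q + a - (y + p) = q - p + a := by abel
  rw [e1] at h1
  rw [e2] at h2
  have e3 : inner ℝ p (∇ J (y + q + a) - ∇ J y) = inner ℝ p (∇ J (y + p) - ∇ J y)
      + inner ℝ p (∇ J (y + q + a) - ∇ J (y + p)) := by
    rw [← inner_add_right]; congr 1; abel
  have h3 : -(‖p‖ * (δ * ‖q - p + a‖)) ≤ inner ℝ p (∇ J (y + q + a) - ∇ J (y + p)) := by
    have := neg_le_of_abs_le (abs_real_inner_le_norm p (∇ J (y + q + a) - ∇ J (y + p)))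
    have h4 := mul_le_mul_of_nonneg_left h2 (norm_nonneg p)
    linarith
  have h4 : ‖p‖ * (δ * ‖q - p + a‖) ≤ ν / 2 * ‖p‖ ^ 2 + δ ^ 2 / (2 * ν) * ‖q - p + a‖ ^ 2 := by
    have : ν / 2 * ‖p‖ ^ 2 + δ ^ 2 / (2 * ν) * ‖q - p + a‖ ^ 2 - ‖p‖ * (δ * ‖q - p + a‖)
        = (ν * ‖p‖ - δ * ‖q - p + a‖) ^ 2 / (2 * ν) := by
      field_simp
      ring
    have : 0 ≤ (ν * ‖p‖ - δ * ‖q - p + a‖) ^ 2 / (2 * ν) := by positivity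
    linarith
  have h5 := mul_le_mul_of_nonneg_left (norm_add_sq_le (q - p) a)
    (show 0 ≤ δ ^ 2 / (2 * ν) by positivity)
  have e4 : δ ^ 2 / (2 * ν) * (2 * (‖q - p‖ ^ 2 + ‖a‖ ^ 2))
      = δ ^ 2 / ν * (‖q - p‖ ^ 2 + ‖a‖ ^ 2) := by
    field_simp
  rw [e3]
  linarith

theorem RiskConditions.norm_sq_gradient_sub_le (hJ : RiskConditions J ν δ) (hν : 0 ≤ ν)
    (hδ : 0 ≤ δ) (y q a : Vec M) :
    ‖∇ J (y + q + a) - ∇ J y‖ ^ 2 ≤ 2 * δ ^ 2 * (‖q‖ ^ 2 + ‖a‖ ^ 2) := by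
  have h1 := hJ.norm_gradient_sub_le hν hδ (y + q + a) y
  rw [show y + q + a - y = q + a by abel] at h1
  have h2 := pow_le_pow_left₀ (norm_nonneg _) h1 2
  rw [mul_pow] at h2
  nlinarith [mul_le_mul_of_nonneg_left (norm_add_sq_le q a) (sq_nonneg δ)]

end Gradient

/-! ### One step of a stochastic gradient recursion in mean square -/

section Moments

variable {Ω : Type*} {m mΩ : MeasurableSpace Ω} {ℙ : Measure Ω}

/-- Integrate `2 ‖s‖² ≤ t⁻¹ ‖s‖⁴ + t` after pulling the `m`-measurable weight `t⁻¹` out of the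
conditional expectation. The condition `1 ≤ t` keeps the weight bounded, hence the product
integrable. -/
theorem integral_norm_sq_le_of_condExp [IsProbabilityMeasure ℙ] {E : Type*}
    [NormedAddCommGroup E] (hm : m ≤ mΩ)
    {s : Ω → E} {t : Ω → ℝ} (hs : MemLp s 4 ℙ) (ht : Measurable[m] t) (hti : Integrable t ℙ)
    (ht1 : ∀ ω, 1 ≤ t ω) (h : ℙ[fun ω => ‖s ω‖ ^ 4 | m] ≤ᵐ[ℙ] fun ω => t ω ^ 2) :
    ∫ ω, ‖s ω‖ ^ 2 ∂ℙ ≤ ∫ ω, t ω ∂ℙ := by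
  have ht0 : ∀ ω, 0 < t ω := fun ω => one_pos.trans_le (ht1 ω)
  have hs4 : Integrable (fun ω => ‖s ω‖ ^ 4) ℙ := hs.integrable_norm_pow (p := 4) (by norm_num)
  have hs2 : Integrable (fun ω => ‖s ω‖ ^ 2) ℙ :=
    (hs.mono_exponent (p := 2) (by norm_num)).integrable_norm_pow (p := 2) (by norm_num)
  have hinv : StronglyMeasurable[m] (fun ω => (t ω)⁻¹) :=
    (Measurable.inv (m := m) ht).stronglyMeasurable
  have hprod : Integrable ((fun ω => (t ω)⁻¹) * fun ω => ‖s ω‖ ^ 4) ℙ := by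
    refine hs4.mono ((hinv.mono hm).aestronglyMeasurable.mul hs4.1) (.of_forall fun ω => ?_)
    simp only [Pi.mul_apply, norm_mul, norm_inv]
    refine mul_le_of_le_one_left (norm_nonneg _) (inv_le_one_of_one_le₀ ?_)
    rw [Real.norm_of_nonneg (ht0 ω).le]
    exact ht1 ω
  have h1 : ∫ ω, (t ω)⁻¹ * ‖s ω‖ ^ 4 ∂ℙ ≤ ∫ ω, t ω ∂ℙ := by
    have e : ∫ ω, (t ω)⁻¹ * ‖s ω‖ ^ 4 ∂ℙ = ∫ ω, ((fun ω => (t ω)⁻¹) * fun ω => ‖s ω‖ ^ 4) ω ∂ℙ :=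
      rfl
    rw [e, ← integral_condExp hm]
    refine integral_mono_ae integrable_condExp hti ?_
    filter_upwards [condExp_mul_of_stronglyMeasurable_left hinv hprod hs4, h] with ω e1 e2
    rw [e1, Pi.mul_apply, inv_mul_le_iff₀ (ht0 ω), ← pow_two]
    exact e2
  have h2 : ∫ ω, 2 * ‖s ω‖ ^ 2 ∂ℙ ≤ ∫ ω, ((t ω)⁻¹ * ‖s ω‖ ^ 4 + t ω) ∂ℙ := by
    refine integral_mono (hs2.const_mul 2) (hprod.add hti) fun ω => ?_
    have e : (t ω)⁻¹ * ‖s ω‖ ^ 4 + t ω - 2 * ‖s ω‖ ^ 2 = (t ω)⁻¹ * (‖s ω‖ ^ 2 - t ω) ^ 2 := by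
      have := (ht0 ω).ne'
      field_simp
      ring
    have : 0 ≤ (t ω)⁻¹ * (‖s ω‖ ^ 2 - t ω) ^ 2 :=
      mul_nonneg (inv_nonneg.2 (ht0 ω).le) (sq_nonneg _)
    simp only
    linarith
  have hprod' : Integrable (fun ω => (t ω)⁻¹ * ‖s ω‖ ^ 4) ℙ := hprod
  rw [integral_const_mul, integral_add hprod' hti] at h2
  linarith

theorem integral_sq_sub_of_condExp_eq_zero [IsProbabilityMeasure ℙ] (hm : m ≤ mΩ) {p n : Ω → ℝ}
    (hp : StronglyMeasurable[m] p) (hp2 : MemLp p 2 ℙ) (hn : MemLp n 2 ℙ)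
    (h : ℙ[n | m] =ᵐ[ℙ] 0) (c : ℝ) :
    ∫ ω, (p ω - c * n ω) ^ 2 ∂ℙ = ∫ ω, p ω ^ 2 ∂ℙ + c ^ 2 * ∫ ω, n ω ^ 2 ∂ℙ := by
  have hpn : Integrable (p * n) ℙ := hp2.integrable_mul hn
  have h0 : ∫ ω, (p * n) ω ∂ℙ = 0 := by
    rw [← integral_condExp hm]
    refine integral_eq_zero_of_ae ?_
    filter_upwards [condExp_mul_of_stronglyMeasurable_left hp hpn (hn.integrable (by norm_num)),
      h] with ω e1 e2
    simp [e1, e2]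
  have e : ∀ ω, (p ω - c * n ω) ^ 2 = p ω ^ 2 + (c ^ 2 * n ω ^ 2 - 2 * c * (p * n) ω) := fun ω => by
    simp only [Pi.mul_apply]; ring
  simp_rw [e]
  have i1 : Integrable (fun ω => c ^ 2 * n ω ^ 2) ℙ := hn.integrable_sq.const_mul _
  have i2 : Integrable (fun ω => 2 * c * (p * n) ω) ℙ := hpn.const_mul _
  have i3 : Integrable (fun ω => c ^ 2 * n ω ^ 2 - 2 * c * (p * n) ω) ℙ := i1.sub i2
  rw [integral_add hp2.integrable_sq i3, integral_sub i1 i2, integral_const_mul,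
    integral_const_mul, h0]
  ring

variable {M : ℕ}

theorem memLp_coord {q : Ω → Vec M} {p : ℝ≥0∞} (hq : MemLp q p ℙ) (j : Fin M) :
    MemLp (fun ω => q ω j) p ℙ :=
  ((EuclideanSpace.proj (𝕜 := ℝ) j : Vec M →L[ℝ] ℝ)).comp_memLp' hq

theorem integrable_sq_coord {q : Ω → Vec M} (hq : MemLp q 2 ℙ) (j : Fin M) :
    Integrable (fun ω => q ω j ^ 2) ℙ :=
  (memLp_coord hq j).integrable_sq

theorem integrable_norm_sq {E : Type*} [NormedAddCommGroup E] {q : Ω → E} (hq : MemLp q 2 ℙ) :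
    Integrable (fun ω => ‖q ω‖ ^ 2) ℙ :=
  hq.integrable_norm_pow (p := 2) (by norm_num)

theorem sum_integral_sq_coord {q : Ω → Vec M} (hq : MemLp q 2 ℙ) :
    ∑ j, ∫ ω, q ω j ^ 2 ∂ℙ = ∫ ω, ‖q ω‖ ^ 2 ∂ℙ := by
  rw [← integral_finsetSum _ fun j _ => integrable_sq_coord hq j]
  simp_rw [EuclideanSpace.real_norm_sq_eq]

theorem condExp_coord_eq_zero {n : Ω → Vec M} (hn : Integrable n ℙ) (h : ℙ[n | m] =ᵐ[ℙ] 0)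
    (j : Fin M) : ℙ[fun ω => n ω j | m] =ᵐ[ℙ] 0 := by
  filter_upwards [(EuclideanSpace.proj (𝕜 := ℝ) j : Vec M →L[ℝ] ℝ).comp_condExp_comm hn (m := m), h]
    with ω e1 e2
  have : ℙ[fun ω => n ω j | m] ω = _ := e1.symm
  rw [this]
  simp [e2]

theorem integral_norm_add_sq_le {p q : Ω → Vec M} (hp : MemLp p 2 ℙ) (hq : MemLp q 2 ℙ) :
    ∫ ω, ‖p ω + q ω‖ ^ 2 ∂ℙ ≤ 2 * (∫ ω, ‖p ω‖ ^ 2 ∂ℙ + ∫ ω, ‖q ω‖ ^ 2 ∂ℙ) := by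
  rw [← integral_add (integrable_norm_sq hp) (integrable_norm_sq hq), ← integral_const_mul]
  exact integral_mono (integrable_norm_sq (hp.add hq))
    (((integrable_norm_sq hp).add (integrable_norm_sq hq)).const_mul 2) fun ω => norm_add_sq_le _ _

variable {J : Vec M → ℝ} {ν δ : ℝ}

theorem RiskConditions.continuous_gradient (hJ : RiskConditions J ν δ) : Continuous (∇ J) :=
  hJ.differentiable_grad.continuous

theorem RiskConditions.memLp_gradient_sub (hJ : RiskConditions J ν δ) (hν : 0 ≤ ν) (hδ : 0 ≤ δ)
    {p : ℝ≥0∞} {a b : Ω → Vec M} (ha : AEStronglyMeasurable a ℙ) (hb : AEStronglyMeasurable b ℙ)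
    (hab : MemLp (fun ω => a ω - b ω) p ℙ) :
    MemLp (fun ω => ∇ J (a ω) - ∇ J (b ω)) p ℙ :=
  hab.of_le_mul (c := δ) ((hJ.continuous_gradient.comp_aestronglyMeasurable ha).sub
    (hJ.continuous_gradient.comp_aestronglyMeasurable hb))
    (.of_forall fun _ => hJ.norm_gradient_sub_le hν hδ _ _)

/-- Dissipation of the energy `∑_{j ∈ S} E q_j² / μ_j` in one step
`q' = q - diag(μ) (∇J(y + q + a) - ∇J(y) + n)` with martingale-difference noise `n`. -/
theorem RiskConditions.energy_step [IsProbabilityMeasure ℙ] (hJ : RiskConditions J ν δ)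
    (hν : 0 < ν) (hδ : 0 ≤ δ)
    (hm : m ≤ mΩ) {y q a n : Ω → Vec M} (hy : StronglyMeasurable[m] y)
    (hq : StronglyMeasurable[m] q) (ha : StronglyMeasurable[m] a) (hq2 : MemLp q 2 ℙ)
    (ha2 : MemLp a 2 ℙ) (hn2 : MemLp n 2 ℙ) (hn : ℙ[n | m] =ᵐ[ℙ] 0) {μ : Fin M → ℝ} {L : ℝ}
    (hμ : ∀ j, 0 < μ j) (hL : ∀ j, μ j ≤ L) (S : Finset (Fin M)) :
    ∑ j ∈ S, (∫ ω, (q ω - diagMul μ (∇ J (y ω + q ω + a ω) - ∇ J (y ω) + n ω)) j ^ 2 ∂ℙ) / μ j ≤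
      ∑ j ∈ S, (∫ ω, q ω j ^ 2 ∂ℙ) / μ j - ν * ∑ j ∈ S, ∫ ω, q ω j ^ 2 ∂ℙ
      + (2 * δ ^ 2 / ν * (∑ j ∈ Sᶜ, ∫ ω, q ω j ^ 2 ∂ℙ + ∫ ω, ‖a ω‖ ^ 2 ∂ℙ)
        + L * (2 * δ ^ 2 * (∫ ω, ‖q ω‖ ^ 2 ∂ℙ + ∫ ω, ‖a ω‖ ^ 2 ∂ℙ) + ∫ ω, ‖n ω‖ ^ 2 ∂ℙ)) := by
  -- Without coordinates nothing forces `0 ≤ L`.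
  rcases isEmpty_or_nonempty (Fin M) with hM | ⟨⟨j₀⟩⟩
  · have h0 : ∀ T : Finset (Fin M), T = ∅ := fun T => Finset.eq_empty_of_isEmpty T
    have hv : ∀ v : Vec M, ‖v‖ ^ 2 = 0 := fun v => by simp [EuclideanSpace.real_norm_sq_eq]
    simp [h0, hv]
  have hL0 : 0 ≤ L := (hμ j₀).le.trans (hL j₀)
  set d : Ω → Vec M := fun ω => ∇ J (y ω + q ω + a ω) - ∇ J (y ω) with hd
  have hdm : StronglyMeasurable[m] d :=
    (hJ.continuous_gradient.comp_stronglyMeasurable ((hy.add hq).add ha)).sub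
      (hJ.continuous_gradient.comp_stronglyMeasurable hy)
  have hd2 : MemLp d 2 ℙ := by
    refine hJ.memLp_gradient_sub hν.le hδ (((hy.add hq).add ha).mono hm).aestronglyMeasurable
      (hy.mono hm).aestronglyMeasurable ?_
    have e : (fun ω => y ω + q ω + a ω - y ω) = q + a := by ext1 ω; simp; abel
    rw [e]
    exact hq2.add ha2
  have hc : ∀ j, Continuous (fun v : Vec M => v j) := fun j => by fun_prop
  have hpm : ∀ j, StronglyMeasurable[m] (fun ω => q ω j - μ j * d ω j) := fun j =>
    ((hc j).comp_stronglyMeasurable hq).sub (((hc j).comp_stronglyMeasurable hdm).const_mul _)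
  have hp2 : ∀ j, MemLp (fun ω => q ω j - μ j * d ω j) 2 ℙ := fun j =>
    (memLp_coord hq2 j).sub ((memLp_coord hd2 j).const_mul _)
  -- The noise is orthogonal to the `m`-measurable part of the step, so only its square remains;
  -- division by `μ j` leaves a single factor `μ j ≤ L`.
  have h1 : ∀ j, ∫ ω, (q ω - diagMul μ (d ω + n ω)) j ^ 2 ∂ℙ =
      ∫ ω, (q ω j - μ j * d ω j) ^ 2 ∂ℙ + μ j ^ 2 * ∫ ω, n ω j ^ 2 ∂ℙ := fun j => by
    rw [← integral_sq_sub_of_condExp_eq_zero hm (hpm j) (hp2 j) (memLp_coord hn2 j)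
      (condExp_coord_eq_zero (hn2.integrable (by norm_num)) hn j)]
    refine integral_congr_ae (.of_forall fun ω => ?_)
    simp only [diagMul, PiLp.sub_apply, PiLp.add_apply]
    ring
  have h2 : ∑ j ∈ S, (∫ ω, (q ω - diagMul μ (d ω + n ω)) j ^ 2 ∂ℙ) / μ j ≤
      ∑ j ∈ S, (∫ ω, (q ω j - μ j * d ω j) ^ 2 ∂ℙ) / μ j + L * ∫ ω, ‖n ω‖ ^ 2 ∂ℙ := by
    rw [← sum_integral_sq_coord hn2, Finset.mul_sum]
    have : ∑ j ∈ S, μ j * ∫ ω, n ω j ^ 2 ∂ℙ ≤ ∑ j, L * ∫ ω, n ω j ^ 2 ∂ℙ := by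
      refine (Finset.sum_le_univ_sum_of_nonneg fun j => ?_).trans
        (Finset.sum_le_sum fun j _ => ?_)
      · exact mul_nonneg (hμ j).le (integral_nonneg fun _ => sq_nonneg _)
      · exact mul_le_mul_of_nonneg_right (hL j) (integral_nonneg fun _ => sq_nonneg _)
    refine le_trans (le_of_eq ?_) (add_le_add_right this _)
    rw [← Finset.sum_add_distrib]
    refine Finset.sum_congr rfl fun j _ => ?_
    have := (hμ j).ne'
    rw [h1]
    field_simp
  have hsum : ∀ T : Finset (Fin M), Integrable (fun ω => ∑ j ∈ T, q ω j ^ 2) ℙ := fun T =>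
    integrable_finsetSum _ fun j _ => integrable_sq_coord hq2 j
  have hsumdiv : Integrable (fun ω => ∑ j ∈ S, q ω j ^ 2 / μ j) ℙ :=
    integrable_finsetSum _ fun j _ => (integrable_sq_coord hq2 j).div_const _
  have i1 : Integrable (fun ω => ν * ∑ j ∈ S, q ω j ^ 2) ℙ := (hsum S).const_mul _
  have i2 : Integrable (fun ω => ∑ j ∈ S, q ω j ^ 2 / μ j - ν * ∑ j ∈ S, q ω j ^ 2) ℙ :=
    hsumdiv.sub i1
  have i3 : Integrable (fun ω => 2 * δ ^ 2 / ν * (∑ j ∈ Sᶜ, q ω j ^ 2 + ‖a ω‖ ^ 2)) ℙ :=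
    ((hsum Sᶜ).add (integrable_norm_sq ha2)).const_mul _
  have i4 : Integrable (fun ω => L * (2 * δ ^ 2 * (‖q ω‖ ^ 2 + ‖a ω‖ ^ 2))) ℙ :=
    (((integrable_norm_sq hq2).add (integrable_norm_sq ha2)).const_mul _).const_mul _
  have i5 : Integrable (fun ω => 2 * δ ^ 2 / ν * (∑ j ∈ Sᶜ, q ω j ^ 2 + ‖a ω‖ ^ 2)
      + L * (2 * δ ^ 2 * (‖q ω‖ ^ 2 + ‖a ω‖ ^ 2))) ℙ := i3.add i4
  have h3 : ∑ j ∈ S, (∫ ω, (q ω j - μ j * d ω j) ^ 2 ∂ℙ) / μ j ≤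
      ∫ ω, (∑ j ∈ S, q ω j ^ 2 / μ j - ν * ∑ j ∈ S, q ω j ^ 2
        + (2 * δ ^ 2 / ν * (∑ j ∈ Sᶜ, q ω j ^ 2 + ‖a ω‖ ^ 2)
          + L * (2 * δ ^ 2 * (‖q ω‖ ^ 2 + ‖a ω‖ ^ 2)))) ∂ℙ := by
    simp_rw [← integral_div]
    rw [← integral_finsetSum _ fun j _ => (hp2 j).integrable_sq.div_const _]
    refine integral_mono (integrable_finsetSum _ fun j _ => (hp2 j).integrable_sq.div_const _)
      (i2.add i5) fun ω => ?_
    have e1 := hJ.le_sum_mul_gradient_sub hν hδ S (y ω) (q ω) (a ω)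
    have e2 := mul_le_mul_of_nonneg_left
      (hJ.norm_sq_gradient_sub_le hν.le hδ (y ω) (q ω) (a ω)) hL0
    have e3 : ∑ j ∈ S, μ j * d ω j ^ 2 ≤ L * ‖d ω‖ ^ 2 := by
      rw [EuclideanSpace.real_norm_sq_eq, Finset.mul_sum]
      refine (Finset.sum_le_univ_sum_of_nonneg fun j => ?_).trans (Finset.sum_le_sum fun j _ => ?_)
      · exact mul_nonneg (hμ j).le (sq_nonneg _)
      · exact mul_le_mul_of_nonneg_right (hL j) (sq_nonneg _)
    have e4 : ∑ j ∈ S, (q ω j - μ j * d ω j) ^ 2 / μ j =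
        ∑ j ∈ S, q ω j ^ 2 / μ j - 2 * ∑ j ∈ S, q ω j * d ω j + ∑ j ∈ S, μ j * d ω j ^ 2 := by
      rw [Finset.mul_sum, ← Finset.sum_sub_distrib, ← Finset.sum_add_distrib]
      refine Finset.sum_congr rfl fun j _ => ?_
      have := (hμ j).ne'
      field_simp
      ring
    simp only
    rw [e4]
    have e5 : 2 * δ ^ 2 / ν * (∑ j ∈ Sᶜ, q ω j ^ 2 + ‖a ω‖ ^ 2) =
        2 * (δ ^ 2 / ν * (∑ j ∈ Sᶜ, q ω j ^ 2 + ‖a ω‖ ^ 2)) := by ring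
    rw [e5]
    simp only [hd] at e3 ⊢
    linarith
  rw [integral_add i2 i5, integral_sub hsumdiv i1, integral_add i3 i4,
    integral_const_mul, integral_const_mul, integral_const_mul, integral_const_mul,
    integral_add (hsum Sᶜ) (integrable_norm_sq ha2),
    integral_add (integrable_norm_sq hq2) (integrable_norm_sq ha2),
    integral_finsetSum _ fun j _ => integrable_sq_coord hq2 j,
    integral_finsetSum _ fun j _ => integrable_sq_coord hq2 j,
    integral_finsetSum _ fun j _ => (integrable_sq_coord hq2 j).div_const _] at h3
  simp_rw [integral_div] at h3
  linarith

end Moments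

/-! ### The mean-square recursions of the momentum method -/

/-- The inequalities between the mean squares `f j` of the components of the error of the averaged
momentum iterate, `U` of the increments, and `g j` of the components of the distance to the standard
iterate, when the step-sizes are `μ j ≤ L`. -/
structure MeanSquareSystem {M : ℕ} (f g : Fin M → ℕ → ℝ) (U : ℕ → ℝ) (μ : Fin M → ℝ)
    (L a b c ε N m : ℝ) : Prop where
  f_nonneg : ∀ j i, 0 ≤ f j i
  g_nonneg : ∀ j i, 0 ≤ g j i
  U_nonneg : ∀ i, 0 ≤ U i
  pos : ∀ j, 0 < μ j
  le : ∀ j, μ j ≤ L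
  f_step : ∀ (S : Finset (Fin M)) i, ∑ j ∈ S, f j (i + 1) / μ j ≤
    ∑ j ∈ S, f j i / μ j - 2 * a * ∑ j ∈ S, f j i
      + (c * (∑ j ∈ Sᶜ, f j i + U i / ε ^ 2) + L * N)
  g_step : ∀ (S : Finset (Fin M)) i, ∑ j ∈ S, g j (i + 1) / μ j ≤
    ∑ j ∈ S, g j i / μ j - 2 * a * ∑ j ∈ S, g j i + c * (∑ j ∈ Sᶜ, g j i + U i / ε ^ 2)
  U_step : ∀ i, U (i + 1) ≤
    (1 - ε) * U i + L ^ 2 / ε * (2 * b * (∑ j, f j i + U i / ε ^ 2) + 2 * N)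
  f_init : ∑ j, f j 0 ≤ m
  g_init : ∑ j, g j 0 ≤ L ^ 2 * m
  U_init : U 0 ≤ L ^ 2 * m

namespace MeanSquareSystem

variable {M : ℕ} {f g : Fin M → ℕ → ℝ} {U : ℕ → ℝ} {μ : Fin M → ℝ} {L a b c ε N m : ℝ}

theorem sum_option (S : Finset (Option (Fin M))) (F : Option (Fin M) → ℝ) :
    ∑ j ∈ S, F j = ∑ j ∈ S.eraseNone, F (some j) + if none ∈ S then F none else 0 := by
  classical
  have h1 : ∑ j ∈ S.erase none, F j = ∑ j ∈ S.eraseNone, F (some j) := by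
    rw [← Finset.map_some_eraseNone, Finset.sum_map]; rfl
  split_ifs with h
  · rw [← Finset.sum_erase_add _ _ h, h1]
  · rw [← h1, Finset.erase_eq_of_notMem h, add_zero]

theorem eraseNone_compl (S : Finset (Option (Fin M))) : Sᶜ.eraseNone = S.eraseNoneᶜ := by
  ext j; simp

/-- The weight of the increments in the joint energy of errors and increments. -/
def weight (a c ε : ℝ) : ℝ := (c / ε ^ 2 + a) / (ε / 2)

/-- The feedback of the increments on themselves is of order `L²` and uses up half of their
contraction margin `ε`. -/
theorem U_step' (h : MeanSquareSystem f g U μ L a b c ε N m)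
    (hL3 : 2 * b * L ^ 2 / ε ^ 3 ≤ ε / 2) (i : ℕ) :
    U (i + 1) ≤ (1 - ε / 2) * U i + L ^ 2 / ε * (2 * b * ∑ j, f j i + 2 * N) := by
  have h1 := h.U_step i
  have h2 := mul_le_mul_of_nonneg_right hL3 (h.U_nonneg i)
  have e : L ^ 2 / ε * (2 * b * (∑ j, f j i + U i / ε ^ 2) + 2 * N) =
      L ^ 2 / ε * (2 * b * ∑ j, f j i + 2 * N) + 2 * b * L ^ 2 / ε ^ 3 * U i := by
    rcases eq_or_ne ε 0 with rfl | hε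
    · simp
    · field_simp; ring
  rw [e] at h1
  linarith

/-- The increments become the coordinate `none` with step-size `(weight a c ε)⁻¹`. The weight is
large enough for their decay to absorb their effect on the errors and leave `a * U`; their own input
from the errors is of order `L²` and costs half of the dissipation `2 * a`. -/
theorem dissipative_joint (h : MeanSquareSystem f g U μ L a b c ε N m) (ha : 0 < a)
    (hc : 0 < c) (hε : 0 < ε) (hε1 : ε ≤ 1) (hN : 0 ≤ N) (hL1 : a * L ≤ 1)
    (hL2 : weight a c ε * (2 * b * L ^ 2 / ε) ≤ a) (hL3 : 2 * b * L ^ 2 / ε ^ 3 ≤ ε / 2) :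
    Dissipative (fun j : Option (Fin M) => j.elim U f)
      (fun _ => L * N + weight a c ε * (L ^ 2 / ε * (2 * N)))
      (fun j => j.elim (weight a c ε)⁻¹ μ) a (c / ε ^ 2 + c + a) := by
  have hw : 0 < weight a c ε := by unfold weight; positivity
  have hwε : weight a c ε * (ε / 2) = c / ε ^ 2 + a := by unfold weight; field_simp
  have hcε : 0 ≤ c / ε ^ 2 := by positivity
  refine ⟨?_, ?_, ?_, ?_⟩
  · rintro (_ | j) i
    exacts [h.U_nonneg i, h.f_nonneg j i]
  · rintro (_ | j)
    exacts [inv_pos.2 hw, h.pos j]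
  · rintro (_ | j)
    · change a * (weight a c ε)⁻¹ ≤ 1
      rw [← div_eq_mul_inv, div_le_one hw]
      nlinarith
    · exact (mul_le_mul_of_nonneg_left (h.le j) ha.le).trans hL1
  · intro S i
    simp only [sum_option, eraseNone_compl, Option.elim_some, Option.elim_none, Finset.mem_compl]
    have h1 := h.f_step S.eraseNone i
    have h2 := mul_le_mul_of_nonneg_left (h.U_step' hL3 i) hw.le
    have hF : 0 ≤ ∑ j ∈ S.eraseNone, f j i := Finset.sum_nonneg fun j _ => h.f_nonneg j i
    have hG : 0 ≤ ∑ j ∈ S.eraseNoneᶜ, f j i := Finset.sum_nonneg fun j _ => h.f_nonneg j i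
    have hFG : ∑ j, f j i = ∑ j ∈ S.eraseNone, f j i + ∑ j ∈ S.eraseNoneᶜ, f j i :=
      (Finset.sum_add_sum_compl _ _).symm
    have hU := h.U_nonneg i
    have e1 : c * (∑ j ∈ S.eraseNoneᶜ, f j i + U i / ε ^ 2) =
      c * ∑ j ∈ S.eraseNoneᶜ, f j i + c / ε ^ 2 * U i := by ring
    rw [e1] at h1
    have p1 := mul_nonneg hcε hG
    have p2 := mul_nonneg ha.le hG
    have p3 := mul_nonneg ha.le hF
    have p4 := mul_nonneg hc.le hU
    have p5 := mul_nonneg ha.le hU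
    have N0 : 0 ≤ weight a c ε * (L ^ 2 / ε * (2 * N)) := by positivity
    have p6 := mul_nonneg hcε hU
    by_cases hn : none ∈ S
    -- If the increments belong to `S`, their decay must pay for the term `c / ε ^ 2 * U`; otherwise
    -- that term is an input, covered by the coefficient `c / ε ^ 2 + c + a`.
    · simp only [hn, if_true, not_true_eq_false, if_false, add_zero, div_inv_eq_mul]
      have e2 : weight a c ε * ((1 - ε / 2) * U i + L ^ 2 / ε * (2 * b * ∑ j, f j i + 2 * N)) =
          weight a c ε * U i - weight a c ε * (ε / 2) * U i
          + weight a c ε * (2 * b * L ^ 2 / ε) * ∑ j, f j i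
          + weight a c ε * (L ^ 2 / ε * (2 * N)) := by ring
      rw [e2, hwε] at h2
      have h3 := mul_le_mul_of_nonneg_right hL2 (hFG ▸ add_nonneg hF hG : 0 ≤ ∑ j, f j i)
      rw [hFG] at h3 h2
      linarith
    · simp only [hn, if_true, not_false_eq_true, if_false, add_zero]
      linarith

theorem dissipative_distance (h : MeanSquareSystem f g U μ L a b c ε N m) (ha : 0 < a)
    (hL1 : a * L ≤ 1) : Dissipative g (fun i => c * (U i / ε ^ 2)) μ a c := by
  refine ⟨h.g_nonneg, h.pos, fun j => (mul_le_mul_of_nonneg_left (h.le j) ha.le).trans hL1,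
    fun S i => ?_⟩
  have h1 := h.g_step S i
  have h2 := mul_nonneg ha.le (Finset.sum_nonneg fun j (_ : j ∈ S) => h.g_nonneg j i)
  linarith

theorem U_le (h : MeanSquareSystem f g U μ L a b c ε N m) (hb : 0 < b) (hε : 0 < ε)
    (hε1 : ε ≤ 1) (hN : 0 ≤ N) (hL3 : 2 * b * L ^ 2 / ε ^ 3 ≤ ε / 2) {A : ℝ} (hA : 0 ≤ A)
    (hm : 0 ≤ m) (hf : ∀ i, ∑ j, f j i ≤ A) (i : ℕ) :
    U i ≤ L ^ 2 * (m + 4 / ε ^ 2 * (b * A + N)) := by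
  refine le_of_contraction (r := ε / 2)
    (b := fun i => 2 / ε * (L ^ 2 / ε * (2 * b * ∑ j, f j i + 2 * N))) (by positivity)
    (by linarith) (fun i => ?_) (fun i => ?_) ?_ i
  · have e : ε / 2 * (2 / ε * (L ^ 2 / ε * (2 * b * ∑ j, f j i + 2 * N))) =
        L ^ 2 / ε * (2 * b * ∑ j, f j i + 2 * N) := by
      field_simp
    rw [e]
    exact h.U_step' hL3 i
  · have e : 2 / ε * (L ^ 2 / ε * (2 * b * ∑ j, f j i + 2 * N)) =
        L ^ 2 * (4 / ε ^ 2 * (b * ∑ j, f j i + N)) := by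
      field_simp; ring
    rw [e]
    have := mul_le_mul_of_nonneg_left (hf i) hb.le
    gcongr
    have : 4 / ε ^ 2 * (b * ∑ j, f j i + N) ≤ 4 / ε ^ 2 * (b * A + N) := by gcongr
    linarith
  · refine h.U_init.trans ?_
    gcongr
    have : 0 ≤ 4 / ε ^ 2 * (b * A + N) := by positivity
    linarith

theorem eventually_U_le (h : MeanSquareSystem f g U μ L a b c ε N m) (hL : 0 < L) (hb : 0 < b)
    (hε : 0 < ε) (hε1 : ε ≤ 1) (hL3 : 2 * b * L ^ 2 / ε ^ 3 ≤ ε / 2) {A : ℝ}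
    (hf : ∀ᶠ i in atTop, ∑ j, f j i ≤ A) :
    ∀ᶠ i in atTop, U i ≤ L ^ 2 * (4 / ε ^ 2 * (b * A + N) + 1) := by
  have := eventually_le_of_contraction (v := U) (r := ε / 2) (η := L ^ 2)
    (B := L ^ 2 * (4 / ε ^ 2 * (b * A + N)))
    (b := fun i => 2 / ε * (L ^ 2 / ε * (2 * b * ∑ j, f j i + 2 * N))) (by positivity)
    (by linarith) (fun i => ?_) ?_ (by positivity)
  · filter_upwards [this] with i hi
    linarith
  · have e : ε / 2 * (2 / ε * (L ^ 2 / ε * (2 * b * ∑ j, f j i + 2 * N))) =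
        L ^ 2 / ε * (2 * b * ∑ j, f j i + 2 * N) := by
      field_simp
    rw [e]
    exact h.U_step' hL3 i
  · filter_upwards [hf] with i hi
    have e : 2 / ε * (L ^ 2 / ε * (2 * b * ∑ j, f j i + 2 * N)) =
        L ^ 2 * (4 / ε ^ 2 * (b * ∑ j, f j i + N)) := by
      field_simp; ring
    rw [e]
    gcongr

end MeanSquareSystem

/-- In a mean-square system with small step-sizes `μ j ≤ L`, the distance of the two iterates is
`O(L ^ 2)` at all times, and asymptotically with a constant independent of the initial state. -/
theorem exists_meanSquareSystem_bound (M : ℕ) {a b c ε N : ℝ} (ha : 0 < a) (hb : 0 < b)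
    (hc : 0 < c) (hε : 0 < ε) (hN : 0 < N) :
    ∃ μ₀ : ℝ, 0 < μ₀ ∧ ∃ Clim : ℝ, ∀ m : ℝ, ∃ C : ℝ,
      ∀ (f g : Fin M → ℕ → ℝ) (U : ℕ → ℝ) (μ : Fin M → ℝ) (L : ℝ), ε ≤ 1 → 0 < L → L ≤ μ₀ →
        MeanSquareSystem f g U μ L a b c ε N m →
        (∀ i, 2 * (∑ j, g j i + U i / ε ^ 2) ≤ C * L ^ 2) ∧
        ∀ᶠ i in atTop, 2 * (∑ j, g j i + U i / ε ^ 2) ≤ Clim * L ^ 2 := by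
  set W := MeanSquareSystem.weight a c ε with hW
  have hw : 0 < W := by rw [hW]; unfold MeanSquareSystem.weight; positivity
  set c' := c / ε ^ 2 + c + a with hc'
  have hc'0 : 0 < c' := by positivity
  set H := N + W * (1 / ε * (2 * N)) with hH
  have hH0 : 0 < H := by positivity
  set K := (3 + c' / a) ^ Fintype.card (Option (Fin M)) with hK
  set K' := (3 + c / a) ^ Fintype.card (Fin M) with hK'
  have hK0 : 0 < K := by positivity
  have hK'0 : 0 < K' := by positivity
  set Alim := K * (H / a) with hAlim
  set Ulim := 4 / ε ^ 2 * (b * Alim + N) + 1 with hUlim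
  have hAlim0 : 0 < Alim := by positivity
  have hUlim0 : 0 < Ulim := by positivity
  -- The bound `1` gives `L ^ 2 ≤ L`, and `1 / a` keeps the contraction factors nonnegative. The
  -- third makes the feedback from errors to increments absorbable, the fourth that of the
  -- increments on themselves. The asymptotic constant is fixed before `m`.
  refine ⟨min (min 1 (1 / a)) (min (a * ε / (W * (2 * b))) (ε ^ 4 / (4 * b))), by positivity,
    2 * (K' * (c * (Ulim / ε ^ 2) / a) + Ulim / ε ^ 2), fun m => ?_⟩
  set A := K * (2 * m + H / a) with hA
  set V := m + 4 / ε ^ 2 * (b * A + N) with hV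
  refine ⟨2 * (K' * (m + c * (V / ε ^ 2) / a) + V / ε ^ 2), fun f g U μ L hε1 hL hL0 h => ?_⟩
  obtain ⟨⟨l1, l2⟩, l3, l4⟩ : (L ≤ 1 ∧ L ≤ 1 / a) ∧
      L ≤ a * ε / (W * (2 * b)) ∧ L ≤ ε ^ 4 / (4 * b) := by
    simpa only [le_min_iff] using hL0
  have hLL : L ^ 2 ≤ L := by nlinarith
  have hL2' : L ^ 2 ≤ 1 := hLL.trans l1
  have hL1 : a * L ≤ 1 := by rwa [le_div_iff₀ ha, mul_comm] at l2
  have hL2 : W * (2 * b * L ^ 2 / ε) ≤ a := by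
    rw [le_div_iff₀ (by positivity)] at l3
    rw [mul_div_assoc', div_le_iff₀ hε]
    refine le_trans ?_ l3
    have := mul_le_mul_of_nonneg_right hLL (show 0 ≤ W * (2 * b) by positivity)
    linarith
  have hL3 : 2 * b * L ^ 2 / ε ^ 3 ≤ ε / 2 := by
    rw [le_div_iff₀ (by positivity)] at l4
    rw [div_le_iff₀ (by positivity)]
    have := mul_le_mul_of_nonneg_right hLL (show 0 ≤ 2 * b by positivity)
    nlinarith
  have hm : 0 ≤ m := (Finset.sum_nonneg fun j _ => h.f_nonneg j 0).trans h.f_init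
  have hA0 : 0 ≤ A := by positivity
  have hV0 : 0 ≤ V := by positivity
  have hjoint := h.dissipative_joint ha hc hε hε1 hN.le hL1 hL2 hL3
  have hdist := h.dissipative_distance ha hL1
  have hinput : L * N + W * (L ^ 2 / ε * (2 * N)) ≤ H := by
    rw [hH]
    gcongr
    exact mul_le_of_le_one_left hN.le l1
  have hsum : ∀ i, ∑ j, f j i ≤ ∑ j : Option (Fin M), j.elim U f i := fun i => by
    rw [Fintype.sum_option]
    simpa using h.U_nonneg i
  have hfA : ∀ i, ∑ j, f j i ≤ A := fun i => by
    refine (hsum i).trans ((hjoint.sum_le ha hc'0.le hH0.le (fun _ => hinput) i).trans ?_)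
    rw [hA]
    gcongr
    rw [Fintype.sum_option]
    have := h.f_init
    have := h.U_init
    have := mul_le_of_le_one_left hm hL2'
    simp only [Option.elim_some, Option.elim_none]
    linarith
  have hfAlim : ∀ᶠ i in atTop, ∑ j, f j i ≤ Alim := by
    filter_upwards [hjoint.eventually_sum_le ha hc'0.le hH0 (.of_forall fun _ => hinput)] with i hi
    exact (hsum i).trans hi
  have hUV := h.U_le hb hε hε1 hN.le hL3 hA0 hm hfA
  have hUlim' := h.eventually_U_le hL hb hε hε1 hL3 hfAlim
  refine ⟨fun i => ?_, ?_⟩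
  · have h1 : ∀ i, c * (U i / ε ^ 2) ≤ c * (L ^ 2 * V / ε ^ 2) := fun i => by
      gcongr
      exact hUV i
    have h2 := hdist.sum_le ha hc.le (by positivity) h1 i
    have h3 : K' * (∑ j, g j 0 + c * (L ^ 2 * V / ε ^ 2) / a) ≤
        K' * (L ^ 2 * m + c * (L ^ 2 * V / ε ^ 2) / a) := by
      gcongr
      exact h.g_init
    have h4 : U i / ε ^ 2 ≤ L ^ 2 * V / ε ^ 2 := by
      gcongr
      exact hUV i
    calc 2 * (∑ j, g j i + U i / ε ^ 2)
        ≤ 2 * (K' * (L ^ 2 * m + c * (L ^ 2 * V / ε ^ 2) / a) + L ^ 2 * V / ε ^ 2) := by linarith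
      _ = _ := by ring
  · have h1 : ∀ᶠ i in atTop, c * (U i / ε ^ 2) ≤ c * (L ^ 2 * Ulim / ε ^ 2) := by
      filter_upwards [hUlim'] with i hi
      gcongr
    filter_upwards [hdist.eventually_sum_le ha hc.le (by positivity) h1, hUlim'] with i h2 h3
    have h4 : U i / ε ^ 2 ≤ L ^ 2 * Ulim / ε ^ 2 := by gcongr
    calc 2 * (∑ j, g j i + U i / ε ^ 2)
        ≤ 2 * (K' * (c * (L ^ 2 * Ulim / ε ^ 2) / a) + L ^ 2 * Ulim / ε ^ 2) := by linarith
      _ = _ := by ring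

/-! ### Diagonal matrices -/

section DiagMul

variable {M : ℕ}

@[simp]
theorem diagMul_apply (d : Fin M → ℝ) (v : Vec M) (j : Fin M) : diagMul d v j = d j * v j := rfl

@[fun_prop]
theorem continuous_diagMul (d : Fin M → ℝ) : Continuous (diagMul d) := by
  unfold diagMul
  fun_prop

theorem norm_sq_diagMul_le {d : Fin M → ℝ} {r : ℝ} (hd : ∀ j, |d j| ≤ r) (v : Vec M) :
    ‖diagMul d v‖ ^ 2 ≤ r ^ 2 * ‖v‖ ^ 2 := by
  simp only [EuclideanSpace.real_norm_sq_eq, diagMul_apply, Finset.mul_sum, mul_pow]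
  exact Finset.sum_le_sum fun j _ => mul_le_mul_of_nonneg_right
    (sq_le_sq' (abs_le.1 (hd j)).1 (abs_le.1 (hd j)).2) (sq_nonneg _)

theorem exists_norm_diagMul_le (d : Fin M → ℝ) : ∃ r, ∀ v, ‖diagMul d v‖ ≤ r * ‖v‖ := by
  refine ⟨∑ j, |d j|, fun v => ?_⟩
  have hr : 0 ≤ ∑ j, |d j| := Finset.sum_nonneg fun j _ => abs_nonneg _
  refine le_of_sq_le_sq ?_ (mul_nonneg hr (norm_nonneg v))
  rw [mul_pow]
  exact norm_sq_diagMul_le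
    (fun j => Finset.single_le_sum (f := fun j => |d j|) (fun j _ => abs_nonneg _)
      (Finset.mem_univ j)) v

theorem memLp_diagMul {Ω : Type*} [MeasurableSpace Ω] {ℙ : Measure Ω} {p : ℝ≥0∞} {q : Ω → Vec M}
    (hq : MemLp q p ℙ) (d : Fin M → ℝ) : MemLp (fun ω => diagMul d (q ω)) p ℙ := by
  obtain ⟨r, hr⟩ := exists_norm_diagMul_le d
  exact hq.of_le_mul ((continuous_diagMul d).comp_aestronglyMeasurable hq.1)
    (.of_forall fun ω => hr (q ω))

theorem integral_norm_sq_diagMul_le {Ω : Type*} [MeasurableSpace Ω] {ℙ : Measure Ω}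
    {q : Ω → Vec M} (hq : MemLp q 2 ℙ) {d : Fin M → ℝ} {r : ℝ} (hd : ∀ j, |d j| ≤ r) :
    ∫ ω, ‖diagMul d (q ω)‖ ^ 2 ∂ℙ ≤ r ^ 2 * ∫ ω, ‖q ω‖ ^ 2 ∂ℙ := by
  rw [← integral_const_mul]
  exact integral_mono (integrable_norm_sq (memLp_diagMul hq d))
    ((integrable_norm_sq hq).const_mul _) fun ω => norm_sq_diagMul_le hd _

/-- Convexity of the square with weights `β` and `1 - β` gives `β u² + (s g)² / (1 - β)`, where `1 -
β ≥ ε`. -/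
theorem sq_momentum_le {β s L ε u g : ℝ} (hβ : 0 ≤ β) (hβε : β ≤ 1 - ε) (hε : 0 < ε)
    (hs : 0 ≤ s) (hsL : s ≤ L) :
    (β * u - s * g) ^ 2 ≤ (1 - ε) * u ^ 2 + L ^ 2 / ε * g ^ 2 := by
  have h1 : s ^ 2 * g ^ 2 ≤ L ^ 2 * g ^ 2 := by gcongr
  have h2 : ε * (β * u - s * g) ^ 2 ≤ ε * (1 - ε) * u ^ 2 + s ^ 2 * g ^ 2 := by
    -- The three nonnegative terms add up exactly to the gap in the inequality.
    have h3 : 0 ≤ (1 - ε - β) * (s * g) ^ 2 := mul_nonneg (by linarith) (sq_nonneg _)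
    have h4 : 0 ≤ ε * (1 - ε - β) * (1 + β) * u ^ 2 :=
      mul_nonneg (mul_nonneg (mul_nonneg hε.le (by linarith)) (by linarith)) (sq_nonneg _)
    have h5 : 0 ≤ β * (ε * u + s * g) ^ 2 := mul_nonneg hβ (sq_nonneg _)
    linarith
  have h3 : ε * ((1 - ε) * u ^ 2 + L ^ 2 / ε * g ^ 2) = ε * (1 - ε) * u ^ 2 + L ^ 2 * g ^ 2 := by
    field_simp
  refine le_of_mul_le_mul_left ?_ hε
  rw [h3]
  linarith

theorem norm_sq_momentum_le {β s : Fin M → ℝ} {L ε : ℝ} (hβ : ∀ j, 0 ≤ β j)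
    (hβε : ∀ j, β j ≤ 1 - ε) (hε : 0 < ε) (hs : ∀ j, 0 ≤ s j) (hsL : ∀ j, s j ≤ L)
    (u g : Vec M) :
    ‖diagMul β u - diagMul s g‖ ^ 2 ≤ (1 - ε) * ‖u‖ ^ 2 + L ^ 2 / ε * ‖g‖ ^ 2 := by
  simp only [EuclideanSpace.real_norm_sq_eq, PiLp.sub_apply, diagMul_apply, Finset.mul_sum]
  rw [← Finset.sum_add_distrib]
  exact Finset.sum_le_sum fun j _ => sq_momentum_le (hβ j) (hβε j) hε (hs j) (hsL j)

theorem integral_norm_sq_le_one_add {Ω : Type*} [MeasurableSpace Ω] {ℙ : Measure Ω}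
    [IsProbabilityMeasure ℙ] {q : Ω → Vec M} (hq : MemLp q 4 ℙ) {r : ℝ}
    (h : ∫ ω, ‖q ω‖ ^ 4 ∂ℙ ≤ r) : ∫ ω, ‖q ω‖ ^ 2 ∂ℙ ≤ 1 + r := by
  have h4 : Integrable (fun ω => ‖q ω‖ ^ 4) ℙ := hq.integrable_norm_pow (p := 4) (by norm_num)
  have h1 : ∫ ω, ‖q ω‖ ^ 2 ∂ℙ ≤ ∫ ω, (1 + ‖q ω‖ ^ 4) ∂ℙ :=
    integral_mono (integrable_norm_sq (hq.mono_exponent (by norm_num)))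
      ((integrable_const 1).add h4) fun ω => by
        change ‖q ω‖ ^ 2 ≤ 1 + ‖q ω‖ ^ 4
        nlinarith [sq_nonneg (‖q ω‖ ^ 2 - 1), sq_nonneg ‖q ω‖]
  rw [integral_add (integrable_const 1) h4, integral_const] at h1
  simp only [probReal_univ, smul_eq_mul, one_mul] at h1
  linarith

end DiagMul

/-! ### The coupled recursions -/

/-- The two recursions driven by the same data, with all the standing assumptions. -/
structure Coupling (M : ℕ) {Ω Θ : Type*} [MeasurableSpace Ω] [MeasurableSpace Θ]
    (ℙ : Measure Ω) (P : Measure Θ) where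
  (Q : Vec M → Θ → ℝ) (θ : ℤ → Ω → Θ) (wo : Vec M)
  (μ μm β₁ β₂ : Fin M → ℝ)
  (w ψ x : ℤ → Ω → Vec M)
  (ν δ γ σ ξ₁ ξ₂ ε m L : ℝ)
  ν_pos : 0 < ν
  ν_le : ν ≤ δ
  ε_pos : 0 < ε
  loss : IsLoss Q P
  data : ∀ i : ℤ, -1 ≤ i → Measurable (θ i)
  minimizer : ∀ v, risk Q P wo ≤ risk Q P v
  momentum : MomentumMatrices β₁ β₂ ε
  μm_pos : ∀ j, 0 < μm j
  μ_eq : ∀ j, μ j = (1 - (β₁ j + β₂ j))⁻¹ * μm j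
  sgd : IsSGD Q θ μ x
  msgd : IsMomentumSGD Q θ μm β₁ β₂ w ψ
  init : ∀ ω, x (-1) ω = w (-2) ω
  init_moments : InitialMoments ℙ Q θ wo w m
  risk_conditions : RiskConditions (risk Q P) ν δ
  noise : NoiseMoments ℙ P Q θ wo w x γ σ
  noise_lipschitz : NoiseLipschitz ℙ P Q θ w ψ x ξ₁ ξ₂
  μ_le : ∀ j, μ j ≤ L

namespace Coupling

variable {M : ℕ} {Ω Θ : Type*} [MeasurableSpace Ω] [MeasurableSpace Θ]
  {ℙ : Measure Ω} {P : Measure Θ} (S : Coupling M ℙ P)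

/-- The risk. -/
def J : Vec M → ℝ := risk S.Q P

/-- The diagonal of `B = B₁ + B₂`. -/
def β (j : Fin M) : ℝ := S.β₁ j + S.β₂ j

/-- The diagonal of `(I - B)⁻¹ B`. -/
def R (j : Fin M) : ℝ := (1 - S.β j)⁻¹ * S.β j

/-- The diagonal of `B₁ - (I - B)⁻¹ B`. -/
def K (j : Fin M) : ℝ := S.β₁ j - S.R j

/-- The past of step `n`. -/
@[reducible] def F (n : ℕ) : MeasurableSpace Ω := history S.w S.x ((n : ℤ) - 1)

/-- The standard iterate before step `n`. -/
def X (n : ℕ) : Ω → Vec M := S.x ((n : ℤ) - 1)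

/-- The point at which the momentum method evaluates the gradient in step `n`. -/
def Y (n : ℕ) : Ω → Vec M := S.ψ ((n : ℤ) - 1)

/-- The increment of the momentum iterate before step `n`. -/
def u (n : ℕ) (ω : Ω) : Vec M := S.w ((n : ℤ) - 1) ω - S.w ((n : ℤ) - 2) ω

/-- The averaged momentum iterate `(I - B)⁻¹ (w_{n-1} - B w_{n-2})`, which follows a standard
stochastic gradient recursion with perturbed evaluation points. -/
def V (n : ℕ) (ω : Ω) : Vec M := S.w ((n : ℤ) - 1) ω + diagMul S.R (S.u n ω)

/-- The perturbation of the evaluation points. -/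
def a (n : ℕ) (ω : Ω) : Vec M := diagMul S.K (S.u n ω)

/-- The stochastic gradient used by the momentum method in step `n`. -/
def G (n : ℕ) (ω : Ω) : Vec M := gradQ S.Q (S.Y n ω) (S.θ n ω)

/-! ### Bounds on the diagonal coefficients -/

theorem β_nonneg (j : Fin M) : 0 ≤ S.β j := add_nonneg (S.momentum.nonneg₁ j) (S.momentum.nonneg₂ j)

theorem β_le (j : Fin M) : S.β j ≤ 1 - S.ε := S.momentum.add_le j

theorem ε_le_one (j : Fin M) : S.ε ≤ 1 := by linarith [S.β_le j, S.β_nonneg j]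

theorem one_sub_β_pos (j : Fin M) : 0 < 1 - S.β j := by linarith [S.β_le j, S.ε_pos]

theorem μ_pos (j : Fin M) : 0 < S.μ j := by
  rw [S.μ_eq]
  exact mul_pos (inv_pos.2 (S.one_sub_β_pos j)) (S.μm_pos j)

theorem μm_eq (j : Fin M) : S.μm j = (1 - S.β j) * S.μ j := by
  rw [S.μ_eq, ← mul_assoc]
  change _ = (1 - S.β j) * (1 - S.β j)⁻¹ * _
  rw [mul_inv_cancel₀ (S.one_sub_β_pos j).ne', one_mul]

theorem μm_le (j : Fin M) : S.μm j ≤ S.L := by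
  rw [S.μm_eq]
  refine le_trans (mul_le_of_le_one_left (S.μ_pos j).le ?_) (S.μ_le j)
  linarith [S.β_nonneg j]

theorem R_nonneg (j : Fin M) : 0 ≤ S.R j :=
  mul_nonneg (inv_nonneg.2 (S.one_sub_β_pos j).le) (S.β_nonneg j)

theorem R_le (j : Fin M) : S.R j ≤ S.ε⁻¹ := by
  have h1 : (1 - S.β j)⁻¹ ≤ S.ε⁻¹ := inv_anti₀ S.ε_pos (by linarith [S.β_le j])
  have h2 : S.β j ≤ 1 := by linarith [S.β_le j, S.ε_pos]
  refine (mul_le_of_le_one_right ?_ h2).trans h1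
  exact inv_nonneg.2 (S.one_sub_β_pos j).le

theorem abs_R_le (j : Fin M) : |S.R j| ≤ S.ε⁻¹ := by
  rw [abs_of_nonneg (S.R_nonneg j)]
  exact S.R_le j

theorem abs_K_le (j : Fin M) : |S.K j| ≤ S.ε⁻¹ := by
  have h1 : 1 ≤ S.ε⁻¹ := (one_le_inv₀ S.ε_pos).2 (S.ε_le_one j)
  have h2 := S.momentum.nonneg₁ j
  have h3 := S.momentum.lt_one₁ j
  have h4 := S.R_nonneg j
  have h5 := S.R_le j
  rw [K, abs_le]
  constructor <;> linarith

theorem δ_pos : 0 < S.δ := S.ν_pos.trans_le S.ν_le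

theorem gradient_wo : ∇ S.J S.wo = 0 := gradient_eq_zero_of_minimizer S.minimizer

/-! Pointwise form of the recursions. -/

theorem Y_eq (n : ℕ) (ω : Ω) :
    S.Y n ω = S.w ((n : ℤ) - 1) ω + diagMul S.β₁ (S.u n ω) :=
  S.msgd.step_psi n (by positivity) ω

theorem Y_eq_V_add (n : ℕ) (ω : Ω) : S.Y n ω = S.V n ω + S.a n ω := by
  rw [Y_eq, V, a]
  ext j
  simp only [PiLp.add_apply, diagMul_apply, K]
  ring

/-- `ψ` and `w` differ by a vector in the range of `B₁`, which `B₂` annihilates. This lets one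
recursion cover both kinds of momentum. -/
theorem β₂_mul_psi (i : ℤ) (hi : 0 ≤ i) (ω : Ω) (j : Fin M) :
    S.β₂ j * S.ψ (i - 1) ω j = S.β₂ j * S.w (i - 1) ω j := by
  rw [S.msgd.step_psi i hi]
  simp only [PiLp.add_apply, diagMul_apply]
  rw [mul_add, ← mul_assoc, mul_comm (S.β₂ j) (S.β₁ j), S.momentum.mul_eq_zero, zero_mul, add_zero]

theorem w_step (n : ℕ) (ω : Ω) :
    S.w n ω = S.w ((n : ℤ) - 1) ω + diagMul S.β (S.u n ω) - diagMul S.μm (S.G n ω) := by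
  have h1 := S.msgd.step_w n (by positivity) ω
  have h2 : ∀ j, S.β₂ j * S.ψ ((n : ℤ) - 2) ω j = S.β₂ j * S.w ((n : ℤ) - 2) ω j := by
    intro j
    rcases n with _ | n
    -- At `n = 0` the point `ψ (-2)` is not given by the recursion but by the initial condition.
    · simp [S.msgd.init_psi]
    · have := S.β₂_mul_psi n (by positivity) ω j
      rwa [show ((n : ℤ) - 1) = ((n + 1 : ℕ) : ℤ) - 2 by push_cast; ring] at this
  have h3 := S.β₂_mul_psi n (by positivity) ω
  rw [h1]
  change S.Y n ω - diagMul S.μm (S.G n ω) + _ = _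
  rw [S.Y_eq]
  ext j
  simp only [PiLp.add_apply, PiLp.sub_apply, diagMul_apply, mul_sub, h2, h3, β, u]
  ring

theorem cast_succ_sub_one (n : ℕ) : ((n + 1 : ℕ) : ℤ) - 1 = n := by push_cast; ring

theorem cast_succ_sub_two (n : ℕ) : ((n + 1 : ℕ) : ℤ) - 2 = n - 1 := by push_cast; ring

theorem u_succ (n : ℕ) (ω : Ω) :
    S.u (n + 1) ω = diagMul S.β (S.u n ω) - diagMul S.μm (S.G n ω) := by
  rw [u, cast_succ_sub_one, cast_succ_sub_two, S.w_step]
  abel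

/-- The coefficients `R` solve `(1 + R) B = R` and `(1 + R) D_m = D`: the momentum term is absorbed,
and the step-size becomes that of the standard method. -/
theorem V_succ (n : ℕ) (ω : Ω) : S.V (n + 1) ω = S.V n ω - diagMul S.μ (S.G n ω) := by
  rw [V, cast_succ_sub_one, S.u_succ, S.w_step, V]
  ext j
  have := (S.one_sub_β_pos j).ne'
  simp only [PiLp.add_apply, PiLp.sub_apply, diagMul_apply, S.μm_eq, R]
  field_simp
  ring

theorem X_succ (n : ℕ) (ω : Ω) :
    S.X (n + 1) ω = S.X n ω - diagMul S.μ (gradQ S.Q (S.X n ω) (S.θ n ω)) := by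
  rw [X, cast_succ_sub_one, S.sgd n (by positivity)]
  rfl

/-- The initial stochastic gradient. -/
def G₀ (ω : Ω) : Vec M := gradQ S.Q (S.w (-2) ω) (S.θ (-1) ω)

theorem u_zero (ω : Ω) : S.u 0 ω = -diagMul S.μm (S.G₀ ω) := by
  have := S.msgd.init_w ω
  simp only [u, CharP.cast_eq_zero, zero_sub, this, G₀]
  abel

theorem V_zero (ω : Ω) : S.V 0 ω = S.w (-2) ω - diagMul S.μ (S.G₀ ω) := by
  have := S.msgd.init_w ω
  rw [V, S.u_zero]
  simp only [CharP.cast_eq_zero, zero_sub, this, G₀]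
  ext j
  have := (S.one_sub_β_pos j).ne'
  simp only [PiLp.add_apply, PiLp.sub_apply, PiLp.neg_apply, diagMul_apply, S.μm_eq, R]
  field_simp
  ring

theorem X_zero (ω : Ω) : S.X 0 ω = S.w (-2) ω := by
  simp [X, S.init]

theorem w_sub_x (n : ℕ) (ω : Ω) :
    S.w n ω - S.x n ω = S.V (n + 1) ω - S.X (n + 1) ω - diagMul S.R (S.u (n + 1) ω) := by
  rw [V, X, cast_succ_sub_one]
  abel

/-! Measurability and integrability. -/

theorem measurable_gradQ {v : Ω → Vec M} (hv : Measurable v) (i : ℤ) (hi : -1 ≤ i) :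
    Measurable (fun ω => gradQ S.Q (v ω) (S.θ i ω)) :=
  S.loss.measurable_grad.comp (hv.prodMk (S.data i hi))

theorem measurable_iterates (n : ℕ) :
    Measurable (S.w ((n : ℤ) - 2)) ∧ Measurable (S.w ((n : ℤ) - 1)) ∧ Measurable (S.X n) := by
  induction n with
  | zero =>
    have h := S.init_moments.measurable
    refine ⟨by simpa using h, ?_, ?_⟩
    · have e : S.w (((0 : ℕ) : ℤ) - 1) = fun ω => S.w (-2) ω - diagMul S.μm (S.G₀ ω) := by
        ext1 ω
        exact S.msgd.init_w ω
      rw [e]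
      exact h.sub ((continuous_diagMul _).measurable.comp (S.measurable_gradQ h _ le_rfl))
    · rw [show S.X 0 = S.w (-2) from funext S.X_zero]
      exact h
  | succ n ih =>
    obtain ⟨h1, h2, h3⟩ := ih
    have hn : (-1 : ℤ) ≤ n := by omega
    have hu : Measurable (S.u n) := h2.sub h1
    have hY : Measurable (S.Y n) := by
      rw [funext (S.Y_eq n)]
      exact h2.add ((continuous_diagMul _).measurable.comp hu)
    refine ⟨by rwa [cast_succ_sub_two], ?_, ?_⟩
    · rw [cast_succ_sub_one, funext (S.w_step n)]
      exact (h2.add ((continuous_diagMul _).measurable.comp hu)).sub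
        ((continuous_diagMul _).measurable.comp (S.measurable_gradQ hY _ hn))
    · rw [funext (S.X_succ n)]
      exact h3.sub ((continuous_diagMul _).measurable.comp (S.measurable_gradQ h3 _ hn))

theorem F_le (n : ℕ) : S.F n ≤ ‹MeasurableSpace Ω› := by
  refine sup_le (iSup₂_le fun i hi => ?_) (iSup₂_le fun i hi => ?_)
  · obtain ⟨k, hk⟩ := Int.eq_ofNat_of_zero_le (show 0 ≤ i + 2 by linarith [hi.1])
    have := (S.measurable_iterates k).1
    rw [← hk, add_sub_cancel_right] at this
    exact this.comap_le
  · obtain ⟨k, hk⟩ := Int.eq_ofNat_of_zero_le (show 0 ≤ i + 1 by linarith [hi.1])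
    have := (S.measurable_iterates k).2.2
    rw [X, ← hk, add_sub_cancel_right] at this
    exact this.comap_le

theorem measurable_w_F (n : ℕ) (i : ℤ) (hi : -2 ≤ i) (hin : i ≤ (n : ℤ) - 1) :
    Measurable[S.F n] (S.w i) :=
  measurable_iff_comap_le.2 <| le_sup_of_le_left <|
    le_iSup₂_of_le (f := fun j (_ : j ∈ Set.Icc (-2 : ℤ) ((n : ℤ) - 1)) =>
      MeasurableSpace.comap (S.w j) inferInstance) i ⟨hi, hin⟩ le_rfl

theorem measurable_X_F (n : ℕ) : Measurable[S.F n] (S.X n) :=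
  measurable_iff_comap_le.2 <| le_sup_of_le_right <|
    le_iSup₂_of_le (f := fun j (_ : j ∈ Set.Icc (-1 : ℤ) ((n : ℤ) - 1)) =>
      MeasurableSpace.comap (S.x j) inferInstance) ((n : ℤ) - 1) ⟨by omega, le_rfl⟩ le_rfl

theorem measurable_u_F (n : ℕ) : Measurable[S.F n] (S.u n) :=
  Measurable.sub (m := S.F n) (S.measurable_w_F n _ (by omega) le_rfl)
    (S.measurable_w_F n _ (by omega) (by omega))

theorem measurable_diagMul_u_F (n : ℕ) (d : Fin M → ℝ) :
    Measurable[S.F n] (fun ω => diagMul d (S.u n ω)) :=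
  (continuous_diagMul d).measurable.comp (S.measurable_u_F n)

theorem measurable_V_F (n : ℕ) : Measurable[S.F n] (S.V n) :=
  Measurable.add (m := S.F n) (S.measurable_w_F n _ (by omega) le_rfl)
    (S.measurable_diagMul_u_F n _)

theorem measurable_a_F (n : ℕ) : Measurable[S.F n] (S.a n) := S.measurable_diagMul_u_F n _

theorem measurable_Y_F (n : ℕ) : Measurable[S.F n] (S.Y n) := by
  rw [funext (S.Y_eq_V_add n)]
  exact Measurable.add (m := S.F n) (S.measurable_V_F n) (S.measurable_a_F n)

/-- The gradient noise of step `n` at `v`. -/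
def N (n : ℕ) (v : Ω → Vec M) : Ω → Vec M := gradNoise S.Q P S.θ n v

theorem gradQ_eq (n : ℕ) (v : Ω → Vec M) (ω : Ω) :
    gradQ S.Q (v ω) (S.θ n ω) = ∇ S.J (v ω) + S.N n v ω := by
  simp [N, gradNoise, J]

theorem memLp_N {n : ℕ} {v : Ω → Vec M} (hv : Measurable[S.F n] v) (hv4 : MemLp v 4 ℙ) :
    MemLp (S.N n v) 4 ℙ :=
  (S.noise n (by positivity) v hv hv4).1

theorem condExp_N {n : ℕ} {v : Ω → Vec M} (hv : Measurable[S.F n] v) (hv4 : MemLp v 4 ℙ) :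
    ℙ[S.N n v | S.F n] =ᵐ[ℙ] 0 :=
  (S.noise n (by positivity) v hv hv4).2.1

section Moments

variable [IsProbabilityMeasure ℙ]

theorem memLp_gradQ {n : ℕ} {v : Ω → Vec M} (hv : Measurable[S.F n] v) (hv4 : MemLp v 4 ℙ) :
    MemLp (fun ω => gradQ S.Q (v ω) (S.θ n ω)) 4 ℙ := by
  have h := S.risk_conditions.memLp_gradient_sub S.ν_pos.le S.δ_pos.le hv4.1
    (aestronglyMeasurable_const (b := S.wo)) (hv4.sub (memLp_const S.wo))
  have e : (fun ω => gradQ S.Q (v ω) (S.θ n ω)) =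
      (fun ω => ∇ (risk S.Q P) (v ω) - ∇ (risk S.Q P) S.wo) + S.N n v := by
    ext1 ω
    rw [S.gradQ_eq, Pi.add_apply]
    have := S.gradient_wo
    simp only [J] at this ⊢
    rw [this, sub_zero]
  rw [e]
  exact h.add (S.memLp_N hv hv4)

/-- The noise hypotheses apply only at adapted points in `L⁴`, so integrability has to be propagated
along the recursions together with adaptedness. -/
theorem memLp_iterates (n : ℕ) :
    MemLp (S.w ((n : ℤ) - 2)) 4 ℙ ∧ MemLp (S.w ((n : ℤ) - 1)) 4 ℙ ∧ MemLp (S.X n) 4 ℙ := by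
  induction n with
  | zero =>
    have h := S.init_moments.memLp
    refine ⟨by simpa using h, ?_, ?_⟩
    · have e : S.w (((0 : ℕ) : ℤ) - 1) = fun ω => S.w (-2) ω - diagMul S.μm (S.G₀ ω) := by
        ext1 ω
        exact S.msgd.init_w ω
      rw [e]
      exact h.sub (memLp_diagMul S.init_moments.memLp_grad _)
    · rw [show S.X 0 = S.w (-2) from funext S.X_zero]
      exact h
  | succ n ih =>
    obtain ⟨h1, h2, h3⟩ := ih
    have hu : MemLp (S.u n) 4 ℙ := h2.sub h1
    have hY : MemLp (S.Y n) 4 ℙ := by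
      rw [funext (S.Y_eq n)]
      exact h2.add (memLp_diagMul hu _)
    refine ⟨by rwa [cast_succ_sub_two], ?_, ?_⟩
    · rw [cast_succ_sub_one, funext (S.w_step n)]
      exact (h2.add (memLp_diagMul hu _)).sub
        (memLp_diagMul (S.memLp_gradQ (S.measurable_Y_F n) hY) _)
    · rw [funext (S.X_succ n)]
      exact h3.sub (memLp_diagMul (S.memLp_gradQ (S.measurable_X_F n) h3) _)

theorem memLp_X (n : ℕ) : MemLp (S.X n) 4 ℙ := (S.memLp_iterates n).2.2

theorem memLp_u (n : ℕ) : MemLp (S.u n) 4 ℙ := (S.memLp_iterates n).2.1.sub (S.memLp_iterates n).1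

theorem memLp_a (n : ℕ) : MemLp (S.a n) 4 ℙ := memLp_diagMul (S.memLp_u n) _

theorem memLp_V (n : ℕ) : MemLp (S.V n) 4 ℙ :=
  (S.memLp_iterates n).2.1.add (memLp_diagMul (S.memLp_u n) _)

theorem memLp_Y (n : ℕ) : MemLp (S.Y n) 4 ℙ := by
  rw [funext (S.Y_eq_V_add n)]
  exact (S.memLp_V n).add (S.memLp_a n)

end Moments

/-! Mean-square inequalities. -/

theorem memLp_two [IsFiniteMeasure ℙ] {q : Ω → Vec M} (hq : MemLp q 4 ℙ) : MemLp q 2 ℙ :=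
  hq.mono_exponent (by norm_num)

/-- The error of the averaged momentum iterate. -/
def e (n : ℕ) (ω : Ω) : Vec M := S.V n ω - S.wo

/-- The distance of the averaged momentum iterate to the standard iterate. -/
def z (n : ℕ) (ω : Ω) : Vec M := S.V n ω - S.X n ω

/-- The coefficient of the mean-square bound on the stochastic gradients. -/
def b : ℝ := 2 * S.δ ^ 2 + 2 * S.γ ^ 2 + 2 * |S.ξ₁|

theorem e_succ (n : ℕ) (ω : Ω) : S.e (n + 1) ω = S.e n ω - diagMul S.μ
    (∇ S.J (S.wo + S.e n ω + S.a n ω) - ∇ S.J S.wo + S.N n (S.Y n) ω) := by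
  have h : S.wo + S.e n ω + S.a n ω = S.Y n ω := by
    rw [S.Y_eq_V_add, e]
    abel
  rw [h, S.gradient_wo, sub_zero, ← S.gradQ_eq, e, S.V_succ, e, G]
  abel

theorem z_succ (n : ℕ) (ω : Ω) : S.z (n + 1) ω = S.z n ω - diagMul S.μ
    (∇ S.J (S.X n ω + S.z n ω + S.a n ω) - ∇ S.J (S.X n ω)
      + (S.N n (S.Y n) ω - S.N n (S.X n) ω)) := by
  have h : S.X n ω + S.z n ω + S.a n ω = S.Y n ω := by
    rw [S.Y_eq_V_add, z]
    abel
  rw [h, z, S.V_succ, S.X_succ, z, G, S.gradQ_eq, S.gradQ_eq]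
  ext j
  simp only [PiLp.add_apply, PiLp.sub_apply, diagMul_apply]
  ring

variable [IsProbabilityMeasure ℙ]

theorem memLp_e (n : ℕ) : MemLp (S.e n) 4 ℙ := (S.memLp_V n).sub (memLp_const _)

theorem memLp_z (n : ℕ) : MemLp (S.z n) 4 ℙ := (S.memLp_V n).sub (S.memLp_X n)

/-- The fourth-moment condition is used with `t = γ² ‖e + a‖² + σ² + 1`; the extra `1` ensures `1 ≤
t`. -/
theorem integral_noise_le (n : ℕ) :
    ∫ ω, ‖S.N n (S.Y n) ω‖ ^ 2 ∂ℙ ≤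
      2 * S.γ ^ 2 * (∫ ω, ‖S.e n ω‖ ^ 2 ∂ℙ + ∫ ω, ‖S.a n ω‖ ^ 2 ∂ℙ) + (S.σ ^ 2 + 1) := by
  have he := memLp_two (S.memLp_e n)
  have ha := memLp_two (S.memLp_a n)
  have hi : Integrable (fun ω => S.γ ^ 2 * ‖S.e n ω + S.a n ω‖ ^ 2) ℙ :=
    (integrable_norm_sq (he.add ha)).const_mul _
  have hme : Measurable[S.F n] (S.e n) :=
    Measurable.sub (m := S.F n) (S.measurable_V_F n) (@measurable_const _ _ _ (S.F n) _)
  have hmea : Measurable[S.F n] (fun ω => S.e n ω + S.a n ω) :=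
    Measurable.add (m := S.F n) hme (S.measurable_a_F n)
  have ht : Measurable[S.F n] (fun ω => S.γ ^ 2 * ‖S.e n ω + S.a n ω‖ ^ 2 + (S.σ ^ 2 + 1)) :=
    (show Continuous fun v : Vec M => S.γ ^ 2 * ‖v‖ ^ 2 + (S.σ ^ 2 + 1) by fun_prop).measurable.comp
      hmea
  have h1 := integral_norm_sq_le_of_condExp (ℙ := ℙ) (S.F_le n)
    (S.memLp_N (S.measurable_Y_F n) (S.memLp_Y n)) ht (hi.add (integrable_const _))
    (fun ω => by
      have : 0 ≤ S.γ ^ 2 * ‖S.e n ω + S.a n ω‖ ^ 2 := by positivity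
      linarith [sq_nonneg S.σ]) (by
      filter_upwards [(S.noise n (by positivity) _ (S.measurable_Y_F n) (S.memLp_Y n)).2.2]
        with ω hω
      refine hω.trans ?_
      have e1 : ‖S.wo - S.Y n ω‖ = ‖S.e n ω + S.a n ω‖ := by
        rw [norm_sub_rev, S.Y_eq_V_add, e]
        congr 1
        abel
      rw [e1]
      have p1 : 0 ≤ S.γ ^ 2 * ‖S.e n ω + S.a n ω‖ ^ 2 := by positivity
      have p2 : 0 ≤ S.σ ^ 2 := sq_nonneg _
      have e2 : S.γ ^ 4 * ‖S.e n ω + S.a n ω‖ ^ 4 + S.σ ^ 4 =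
        (S.γ ^ 2 * ‖S.e n ω + S.a n ω‖ ^ 2) ^ 2 + (S.σ ^ 2) ^ 2 := by ring
      rw [e2]
      nlinarith [mul_nonneg p1 p2])
  rw [integral_add hi (integrable_const _), integral_const_mul, integral_const] at h1
  simp only [probReal_univ, smul_eq_mul, one_mul] at h1
  have h2 := mul_le_mul_of_nonneg_left (integral_norm_add_sq_le he ha) (sq_nonneg S.γ)
  linarith

/-- There is no additive constant here, in contrast to the noise driving `e`. This is why `z`
inherits the order `L²` of the increments instead of the order `L` of a stochastic gradient error.
-/
theorem integral_noise_sub_le (n : ℕ) :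
    ∫ ω, ‖S.N n (S.Y n) ω - S.N n (S.X n) ω‖ ^ 2 ∂ℙ ≤
      2 * |S.ξ₁| * (∫ ω, ‖S.z n ω‖ ^ 2 ∂ℙ + ∫ ω, ‖S.a n ω‖ ^ 2 ∂ℙ) := by
  have hz := memLp_two (S.memLp_z n)
  have ha := memLp_two (S.memLp_a n)
  have h2 := mul_le_mul_of_nonneg_left (integral_norm_add_sq_le hz ha) (abs_nonneg S.ξ₁)
  have hi : Integrable (fun ω => |S.ξ₁| * ‖S.z n ω + S.a n ω‖ ^ 2) ℙ :=
    (integrable_norm_sq (hz.add ha)).const_mul _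
  rw [← integral_const_mul] at h2
  refine le_trans ?_ (h2.trans (by linarith))
  rw [← integral_condExp (S.F_le n)]
  refine integral_mono_ae integrable_condExp hi ?_
  filter_upwards [(S.noise_lipschitz n (by positivity)).1] with ω hω
  refine hω.trans ?_
  have e1 : S.ψ ((n : ℤ) - 1) ω - S.x ((n : ℤ) - 1) ω = S.z n ω + S.a n ω := by
    change S.Y n ω - S.X n ω = _
    rw [S.Y_eq_V_add, z]
    abel
  rw [e1]
  exact mul_le_mul_of_nonneg_right (le_abs_self _) (sq_nonneg _)

theorem integral_a_le (n : ℕ) :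
    ∫ ω, ‖S.a n ω‖ ^ 2 ∂ℙ ≤ (∫ ω, ‖S.u n ω‖ ^ 2 ∂ℙ) / S.ε ^ 2 := by
  have := integral_norm_sq_diagMul_le (memLp_two (S.memLp_u n)) S.abs_K_le
  rwa [inv_pow, inv_mul_eq_div] at this

/-- Collects the terms of an energy inequality when the step-sizes are small. -/
theorem dissipation_le {ν δ L b b' E Fs Fc A U N V : ℝ} (hν : 0 < ν) (hL : 0 ≤ L)
    (hb : 2 * δ ^ 2 + b' ≤ b) (hLb : L * b ≤ ν / 2) (hFs : 0 ≤ Fs) (hFc : 0 ≤ Fc) (hA : 0 ≤ A)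
    (hAU : A ≤ U) (hE : E ≤ b' * (Fs + Fc + A) + N) :
    V - ν * Fs + (2 * δ ^ 2 / ν * (Fc + A) + L * (2 * δ ^ 2 * (Fs + Fc + A) + E)) ≤
      V - 2 * (ν / 4) * Fs + ((2 * δ ^ 2 / ν + ν / 2) * (Fc + U) + L * N) := by
  have h1 : 2 * δ ^ 2 * (Fs + Fc + A) + E ≤ b * (Fs + Fc + A) + N := by
    have := mul_le_mul_of_nonneg_right hb (show 0 ≤ Fs + Fc + A by linarith)
    linarith
  have h2 := mul_le_mul_of_nonneg_left h1 hL
  -- The second-order terms are bounded by `ν / 2` times the mean squares: the `Fs` part halves the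
  -- dissipation, the rest supplies the summand `ν / 2` of the input coefficient.
  have h3 := mul_le_mul_of_nonneg_right hLb (show 0 ≤ Fs + Fc + A by linarith)
  have h4 : (2 * δ ^ 2 / ν + ν / 2) * (Fc + A) ≤ (2 * δ ^ 2 / ν + ν / 2) * (Fc + U) := by gcongr
  linarith

theorem e_step (hL : 0 ≤ S.L) (hLb : S.L * S.b ≤ S.ν / 2) (T : Finset (Fin M)) (n : ℕ) :
    ∑ j ∈ T, (∫ ω, S.e (n + 1) ω j ^ 2 ∂ℙ) / S.μ j ≤
      ∑ j ∈ T, (∫ ω, S.e n ω j ^ 2 ∂ℙ) / S.μ j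
        - 2 * (S.ν / 4) * ∑ j ∈ T, ∫ ω, S.e n ω j ^ 2 ∂ℙ
        + ((2 * S.δ ^ 2 / S.ν + S.ν / 2) * (∑ j ∈ Tᶜ, ∫ ω, S.e n ω j ^ 2 ∂ℙ
          + (∫ ω, ‖S.u n ω‖ ^ 2 ∂ℙ) / S.ε ^ 2) + S.L * (S.σ ^ 2 + 1)) := by
  have hme : Measurable[S.F n] (S.e n) :=
    Measurable.sub (m := S.F n) (S.measurable_V_F n) (@measurable_const _ _ _ (S.F n) _)
  have h1 := S.risk_conditions.energy_step (ℙ := ℙ) S.ν_pos S.δ_pos.le (S.F_le n)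
    (y := fun _ => S.wo) stronglyMeasurable_const hme.stronglyMeasurable
    (S.measurable_a_F n).stronglyMeasurable (memLp_two (S.memLp_e n)) (memLp_two (S.memLp_a n))
    (memLp_two (S.memLp_N (S.measurable_Y_F n) (S.memLp_Y n)))
    (S.condExp_N (S.measurable_Y_F n) (S.memLp_Y n)) S.μ_pos S.μ_le T
  have h2 := S.integral_noise_le n
  rw [← sum_integral_sq_coord (memLp_two (S.memLp_e n)), ← Finset.sum_add_sum_compl T] at h1 h2
  simp_rw [S.e_succ]
  refine h1.trans (dissipation_le S.ν_pos hL ?_ hLb ?_ ?_ ?_ (S.integral_a_le n) h2)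
  · rw [b]
    linarith [abs_nonneg S.ξ₁]
  · exact Finset.sum_nonneg fun j _ => integral_nonneg fun _ => sq_nonneg _
  · exact Finset.sum_nonneg fun j _ => integral_nonneg fun _ => sq_nonneg _
  · exact integral_nonneg fun _ => sq_nonneg _

theorem z_step (hL : 0 ≤ S.L) (hLb : S.L * S.b ≤ S.ν / 2) (T : Finset (Fin M)) (n : ℕ) :
    ∑ j ∈ T, (∫ ω, S.z (n + 1) ω j ^ 2 ∂ℙ) / S.μ j ≤
      ∑ j ∈ T, (∫ ω, S.z n ω j ^ 2 ∂ℙ) / S.μ j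
        - 2 * (S.ν / 4) * ∑ j ∈ T, ∫ ω, S.z n ω j ^ 2 ∂ℙ
        + (2 * S.δ ^ 2 / S.ν + S.ν / 2) * (∑ j ∈ Tᶜ, ∫ ω, S.z n ω j ^ 2 ∂ℙ
          + (∫ ω, ‖S.u n ω‖ ^ 2 ∂ℙ) / S.ε ^ 2) := by
  have hmz : Measurable[S.F n] (S.z n) :=
    Measurable.sub (m := S.F n) (S.measurable_V_F n) (S.measurable_X_F n)
  have hY := S.memLp_N (S.measurable_Y_F n) (S.memLp_Y n)
  have hX := S.memLp_N (S.measurable_X_F n) (S.memLp_X n)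
  have hcond : ℙ[S.N n (S.Y n) - S.N n (S.X n) | S.F n] =ᵐ[ℙ] 0 := by
    filter_upwards [condExp_sub (hY.integrable (by norm_num)) (hX.integrable (by norm_num)) (S.F n),
      S.condExp_N (S.measurable_Y_F n) (S.memLp_Y n),
      S.condExp_N (S.measurable_X_F n) (S.memLp_X n)] with ω e1 e2 e3
    rw [e1, Pi.sub_apply, e2, e3, sub_self]
    rfl
  have h1 := S.risk_conditions.energy_step (ℙ := ℙ) S.ν_pos S.δ_pos.le (S.F_le n)
    (S.measurable_X_F n).stronglyMeasurable hmz.stronglyMeasurable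
    (S.measurable_a_F n).stronglyMeasurable (memLp_two (S.memLp_z n)) (memLp_two (S.memLp_a n))
    (memLp_two (hY.sub hX)) hcond S.μ_pos S.μ_le T
  have h2 := S.integral_noise_sub_le n
  -- Brings the bound to the form required by `dissipation_le`, with additive noise level `0`.
  rw [← add_zero (2 * |S.ξ₁| * _)] at h2
  simp only [Pi.sub_apply] at h1
  rw [← sum_integral_sq_coord (memLp_two (S.memLp_z n)), ← Finset.sum_add_sum_compl T] at h1 h2
  simp_rw [S.z_succ]
  refine h1.trans ((dissipation_le S.ν_pos hL ?_ hLb ?_ ?_ ?_ (S.integral_a_le n) h2).trans ?_)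
  · rw [b]
    linarith [sq_nonneg S.γ]
  · exact Finset.sum_nonneg fun j _ => integral_nonneg fun _ => sq_nonneg _
  · exact Finset.sum_nonneg fun j _ => integral_nonneg fun _ => sq_nonneg _
  · exact integral_nonneg fun _ => sq_nonneg _
  · rw [mul_zero, add_zero]

theorem integral_G_le (n : ℕ) :
    ∫ ω, ‖S.G n ω‖ ^ 2 ∂ℙ ≤ 2 * S.b * (∑ j, ∫ ω, S.e n ω j ^ 2 ∂ℙ
      + (∫ ω, ‖S.u n ω‖ ^ 2 ∂ℙ) / S.ε ^ 2) + 2 * (S.σ ^ 2 + 1) := by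
  have he := memLp_two (S.memLp_e n)
  have ha := memLp_two (S.memLp_a n)
  have hN := memLp_two (S.memLp_N (S.measurable_Y_F n) (S.memLp_Y n))
  set d : Ω → Vec M := fun ω => ∇ S.J (S.wo + S.e n ω + S.a n ω) - ∇ S.J S.wo with hd
  have hd2 : MemLp d 2 ℙ := by
    refine S.risk_conditions.memLp_gradient_sub S.ν_pos.le S.δ_pos.le
      ((aestronglyMeasurable_const.add he.1).add ha.1) aestronglyMeasurable_const ?_
    have e1 : (fun ω => S.wo + S.e n ω + S.a n ω - S.wo) = S.e n + S.a n := by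
      ext1 ω
      simp only [Pi.add_apply]
      abel
    rw [e1]
    exact he.add ha
  have hG : S.G n = fun ω => d ω + S.N n (S.Y n) ω := by
    ext1 ω
    have h : S.wo + S.e n ω + S.a n ω = S.Y n ω := by
      rw [S.Y_eq_V_add, e]
      abel
    rw [hd]
    simp only
    rw [h, S.gradient_wo, sub_zero, ← S.gradQ_eq, G]
  have h1 : ∫ ω, ‖d ω‖ ^ 2 ∂ℙ ≤
      2 * S.δ ^ 2 * (∫ ω, ‖S.e n ω‖ ^ 2 ∂ℙ + ∫ ω, ‖S.a n ω‖ ^ 2 ∂ℙ) := by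
    rw [← integral_add (integrable_norm_sq he) (integrable_norm_sq ha), ← integral_const_mul]
    exact integral_mono (integrable_norm_sq hd2)
      (((integrable_norm_sq he).add (integrable_norm_sq ha)).const_mul _)
      fun ω => S.risk_conditions.norm_sq_gradient_sub_le S.ν_pos.le S.δ_pos.le _ _ _
  have h2 := S.integral_noise_le n
  have h3 := integral_norm_add_sq_le hd2 hN
  have h4 := S.integral_a_le n
  have h5 : 0 ≤ ∫ ω, ‖S.e n ω‖ ^ 2 ∂ℙ := integral_nonneg fun _ => sq_nonneg _
  have h6 : 0 ≤ ∫ ω, ‖S.a n ω‖ ^ 2 ∂ℙ := integral_nonneg fun _ => sq_nonneg _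
  have hb : 2 * S.δ ^ 2 + 2 * S.γ ^ 2 ≤ S.b := by
    rw [b]
    linarith [abs_nonneg S.ξ₁]
  have hb0 : 0 ≤ S.b := le_trans (by positivity) hb
  rw [sum_integral_sq_coord he, hG]
  have h7 := mul_le_mul_of_nonneg_right hb (add_nonneg h5 h6)
  have h8 := mul_le_mul_of_nonneg_left h4 hb0
  linarith

theorem u_step (n : ℕ) :
    ∫ ω, ‖S.u (n + 1) ω‖ ^ 2 ∂ℙ ≤ (1 - S.ε) * ∫ ω, ‖S.u n ω‖ ^ 2 ∂ℙ
      + S.L ^ 2 / S.ε * (2 * S.b * (∑ j, ∫ ω, S.e n ω j ^ 2 ∂ℙ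
      + (∫ ω, ‖S.u n ω‖ ^ 2 ∂ℙ) / S.ε ^ 2) + 2 * (S.σ ^ 2 + 1)) := by
  have hu := memLp_two (S.memLp_u n)
  have hG : MemLp (S.G n) 2 ℙ := memLp_two (S.memLp_gradQ (S.measurable_Y_F n) (S.memLp_Y n))
  have h1 : ∫ ω, ‖S.u (n + 1) ω‖ ^ 2 ∂ℙ ≤
      ∫ ω, ((1 - S.ε) * ‖S.u n ω‖ ^ 2 + S.L ^ 2 / S.ε * ‖S.G n ω‖ ^ 2) ∂ℙ := by
    refine integral_mono (integrable_norm_sq (memLp_two (S.memLp_u (n + 1))))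
      (((integrable_norm_sq hu).const_mul _).add ((integrable_norm_sq hG).const_mul _)) fun ω => ?_
    simp only
    rw [S.u_succ]
    exact norm_sq_momentum_le S.β_nonneg S.β_le S.ε_pos (fun j => (S.μm_pos j).le) S.μm_le _ _
  rw [integral_add ((integrable_norm_sq hu).const_mul _) ((integrable_norm_sq hG).const_mul _),
    integral_const_mul, integral_const_mul] at h1
  have := S.ε_pos
  have h2 := mul_le_mul_of_nonneg_left (S.integral_G_le n)
    (show 0 ≤ S.L ^ 2 / S.ε by positivity)
  linarith

/-! ### Initial mean squares -/

theorem integral_G₀_le : ∫ ω, ‖S.G₀ ω‖ ^ 2 ∂ℙ ≤ 1 + S.m :=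
  integral_norm_sq_le_one_add S.init_moments.memLp_grad S.init_moments.bound_grad

theorem memLp_G₀ : MemLp S.G₀ 2 ℙ := memLp_two S.init_moments.memLp_grad

theorem integral_diagMul_G₀_le {d : Fin M → ℝ} (hd : ∀ j, 0 ≤ d j) (hdL : ∀ j, d j ≤ S.L) :
    ∫ ω, ‖diagMul d (S.G₀ ω)‖ ^ 2 ∂ℙ ≤ S.L ^ 2 * (1 + S.m) :=
  (integral_norm_sq_diagMul_le S.memLp_G₀
    fun j => (abs_of_nonneg (hd j)).trans_le (hdL j)).trans
    (mul_le_mul_of_nonneg_left S.integral_G₀_le (sq_nonneg _))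

theorem one_add_m_nonneg : 0 ≤ 1 + S.m :=
  (integral_nonneg fun _ => sq_nonneg _).trans S.integral_G₀_le

theorem e_init (hL0 : 0 ≤ S.L) (hL : S.L ≤ 1) :
    ∑ j, ∫ ω, S.e 0 ω j ^ 2 ∂ℙ ≤ 4 * (1 + S.m) := by
  rw [sum_integral_sq_coord (memLp_two (S.memLp_e 0))]
  have hw : MemLp (fun ω => S.w (-2) ω - S.wo) 4 ℙ := S.init_moments.memLp.sub (memLp_const _)
  have h1 : ∫ ω, ‖S.w (-2) ω - S.wo‖ ^ 2 ∂ℙ ≤ 1 + S.m :=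
    integral_norm_sq_le_one_add hw (by
      simp_rw [norm_sub_rev _ S.wo]
      exact S.init_moments.bound)
  have h2 := integral_norm_add_sq_le (memLp_two hw) (memLp_diagMul S.memLp_G₀ S.μ).neg
  have h3 := S.integral_diagMul_G₀_le (fun j => (S.μ_pos j).le) S.μ_le
  have h4 : ∀ ω, S.e 0 ω = S.w (-2) ω - S.wo + (-fun ω => diagMul S.μ (S.G₀ ω)) ω := fun ω => by
    rw [e, S.V_zero, Pi.neg_apply]
    abel
  simp_rw [h4]
  simp only [Pi.neg_apply, norm_neg] at h2 ⊢
  have h5 := mul_le_mul_of_nonneg_right (pow_le_one₀ hL0 hL : S.L ^ 2 ≤ 1) S.one_add_m_nonneg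
  linarith

theorem u_init : ∫ ω, ‖S.u 0 ω‖ ^ 2 ∂ℙ ≤ S.L ^ 2 * (4 * (1 + S.m)) := by
  simp_rw [S.u_zero, norm_neg]
  refine (S.integral_diagMul_G₀_le (fun j => (S.μm_pos j).le) S.μm_le).trans ?_
  exact mul_le_mul_of_nonneg_left (by linarith [S.one_add_m_nonneg]) (sq_nonneg _)

/-- The first momentum step displaces `V` from the common initial point by exactly `diagMul S.μ
(S.G₀ ω)`, so the distance is already of order `L` at the start. -/
theorem z_init : ∑ j, ∫ ω, S.z 0 ω j ^ 2 ∂ℙ ≤ S.L ^ 2 * (4 * (1 + S.m)) := by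
  rw [sum_integral_sq_coord (memLp_two (S.memLp_z 0))]
  have h4 : ∀ ω, S.z 0 ω = -diagMul S.μ (S.G₀ ω) := fun ω => by
    rw [z, S.V_zero, S.X_zero]
    abel
  simp_rw [h4, norm_neg]
  refine (S.integral_diagMul_G₀_le (fun j => (S.μ_pos j).le) S.μ_le).trans ?_
  exact mul_le_mul_of_nonneg_left (by linarith [S.one_add_m_nonneg]) (sq_nonneg _)

theorem meanSquareSystem (hL0 : 0 ≤ S.L) (hL : S.L ≤ 1) (hLb : S.L * S.b ≤ S.ν / 2) :
    MeanSquareSystem (fun j n => ∫ ω, S.e n ω j ^ 2 ∂ℙ) (fun j n => ∫ ω, S.z n ω j ^ 2 ∂ℙ)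
      (fun n => ∫ ω, ‖S.u n ω‖ ^ 2 ∂ℙ) S.μ S.L (S.ν / 4) S.b (2 * S.δ ^ 2 / S.ν + S.ν / 2)
      S.ε (S.σ ^ 2 + 1) (4 * (1 + S.m)) where
  f_nonneg _ _ := integral_nonneg fun _ => sq_nonneg _
  g_nonneg _ _ := integral_nonneg fun _ => sq_nonneg _
  U_nonneg _ := integral_nonneg fun _ => sq_nonneg _
  pos := S.μ_pos
  le := S.μ_le
  f_step := S.e_step hL0 hLb
  g_step := S.z_step hL0 hLb
  U_step := S.u_step
  f_init := S.e_init hL0 hL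
  g_init := S.z_init
  U_init := S.u_init

/-! ### From the averaged iterate back to the momentum iterate -/

theorem integrable_distance (n : ℕ) : Integrable (fun ω => ‖S.w n ω - S.x n ω‖ ^ 2) ℙ := by
  simp_rw [S.w_sub_x]
  exact integrable_norm_sq ((memLp_two (S.memLp_z (n + 1))).sub
    (memLp_diagMul (memLp_two (S.memLp_u (n + 1))) _))

theorem integral_distance_le (n : ℕ) :
    ∫ ω, ‖S.w n ω - S.x n ω‖ ^ 2 ∂ℙ ≤ 2 * (∑ j, ∫ ω, S.z (n + 1) ω j ^ 2 ∂ℙ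
      + (∫ ω, ‖S.u (n + 1) ω‖ ^ 2 ∂ℙ) / S.ε ^ 2) := by
  have hz := memLp_two (S.memLp_z (n + 1))
  have hu := memLp_two (S.memLp_u (n + 1))
  have h1 := integral_norm_add_sq_le hz (memLp_diagMul hu S.R).neg
  have h2 := integral_norm_sq_diagMul_le hu S.abs_R_le
  rw [inv_pow, inv_mul_eq_div] at h2
  simp only [Pi.neg_apply, norm_neg, ← sub_eq_add_neg] at h1
  rw [sum_integral_sq_coord hz]
  simp_rw [S.w_sub_x]
  refine h1.trans ?_
  linarith

end Coupling

end MomentumSGD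

end

/-! ### The main theorem -/

theorem mainTheorem7 (M : ℕ) (ν δ γ σ ξ₁ ξ₂ κ ε : ℝ) (hν : 0 < ν) (hνδ : ν ≤ δ) (hε : 0 < ε) :
    ∃ μ₀ : ℝ, 0 < μ₀ ∧ ∃ Clim : ℝ, ∀ m : ℝ, ∃ C : ℝ,
      ∀ (Ω : Type*) [MeasurableSpace Ω] (ℙ : Measure Ω) [IsProbabilityMeasure ℙ]
        (Θ : Type*) [MeasurableSpace Θ] (P : Measure Θ) [IsProbabilityMeasure P]
        (Q : MomentumSGD.Vec M → Θ → ℝ) (θ : ℤ → Ω → Θ) (wo : MomentumSGD.Vec M)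
        (μ μm β₁ β₂ : Fin M → ℝ) (w ψ x : ℤ → Ω → MomentumSGD.Vec M),
        -- the data have the law that defines the risk, and `wo` minimizes the risk
        MomentumSGD.IsLoss Q P →
        (∀ i : ℤ, -1 ≤ i → Measurable (θ i) ∧ Measure.map (θ i) ℙ = P) →
        (∀ v, MomentumSGD.risk Q P wo ≤ MomentumSGD.risk Q P v) →
        -- the two recursions, their step-sizes and their common initial state
        MomentumSGD.MomentumMatrices β₁ β₂ ε →
        (∀ j, 0 < μm j) →
        (∀ j, μ j = (1 - (β₁ j + β₂ j))⁻¹ * μm j) →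
        MomentumSGD.IsSGD Q θ μ x →
        MomentumSGD.IsMomentumSGD Q θ μm β₁ β₂ w ψ →
        (∀ ω, x (-1) ω = w (-2) ω) →
        MomentumSGD.InitialMoments ℙ Q θ wo w m →
        -- the assumptions on the risk and on the gradient noise
        MomentumSGD.RiskConditions (MomentumSGD.risk Q P) ν δ →
        MomentumSGD.HessianLipschitz (MomentumSGD.risk Q P) κ →
        MomentumSGD.NoiseMoments ℙ P Q θ wo w x γ σ →
        MomentumSGD.NoiseLipschitz ℙ P Q θ w ψ x ξ₁ ξ₂ →
        -- sufficiently small step-sizes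
        MomentumSGD.maxEntry μ ≤ μ₀ →
        (∀ i : ℕ,
          Integrable (fun ω => ‖(wo - w i ω) - (wo - x i ω)‖ ^ 2) ℙ ∧
          ∫ ω, ‖(wo - w i ω) - (wo - x i ω)‖ ^ 2 ∂ℙ
            ≤ C * MomentumSGD.maxEntry μ ^ (3 / 2 : ℝ)) ∧
        limsup (fun i : ℕ => ∫ ω, ‖(wo - w i ω) - (wo - x i ω)‖ ^ 2 ∂ℙ) atTop
          ≤ Clim * MomentumSGD.maxEntry μ ^ 2 := by
  have hδ : 0 < δ := hν.trans_le hνδ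
  have hb : 0 < 2 * δ ^ 2 + 2 * γ ^ 2 + 2 * |ξ₁| := by positivity
  obtain ⟨μ₀, hμ₀, Clim, h⟩ := MomentumSGD.exists_meanSquareSystem_bound M
    (a := ν / 4) (b := 2 * δ ^ 2 + 2 * γ ^ 2 + 2 * |ξ₁|) (c := 2 * δ ^ 2 / ν + ν / 2)
    (N := σ ^ 2 + 1) (by positivity) hb (by positivity) hε (by positivity)
  -- The bound `1` controls the initial error and compares `L ^ 2` with `L ^ (3 / 2)`; the last
  -- bound is the condition `L * b ≤ ν / 2` of the energy steps.
  refine ⟨min μ₀ (min 1 (ν / 2 / (2 * δ ^ 2 + 2 * γ ^ 2 + 2 * |ξ₁|))), by positivity, Clim,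
    fun m => ?_⟩
  obtain ⟨C, hC⟩ := h (4 * (1 + m))
  -- A nonnegative constant is needed to pass from `L ^ 2` to `L ^ (3 / 2)`.
  refine ⟨max C 0, ?_⟩
  intro Ω _ ℙ _ Θ _ P _ Q θ wo μ μm β₁ β₂ w ψ x hloss hdata hmin hmom hμm hμ hsgd hmsgd hinit hm
    hrisk _ hnoise hlip hsmall
  have hdist : ∀ (i : ℕ) ω, (wo - w i ω) - (wo - x i ω) = -(w i ω - x i ω) := fun i ω => by abel
  simp_rw [hdist, norm_neg]
  -- In dimension zero `maxEntry μ` is the empty supremum `0`, so `0 < L` fails, but both sides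
  -- vanish.
  rcases isEmpty_or_nonempty (Fin M) with hM | ⟨⟨j₀⟩⟩
  · have h0 : ∀ v : MomentumSGD.Vec M, ‖v‖ ^ 2 = 0 := fun v => by
      simp [EuclideanSpace.real_norm_sq_eq]
    have hmax : MomentumSGD.maxEntry μ = 0 := by simp [MomentumSGD.maxEntry]
    simp only [h0, hmax, integral_zero]
    norm_num
  set L := MomentumSGD.maxEntry μ with hL
  have hle : ∀ j, μ j ≤ L := fun j => le_ciSup (Set.finite_range μ).bddAbove j
  let S : MomentumSGD.Coupling M ℙ P :=
    { Q := Q, θ := θ, wo := wo, μ := μ, μm := μm, β₁ := β₁, β₂ := β₂, w := w, ψ := ψ, x := x,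
      ν := ν, δ := δ, γ := γ, σ := σ, ξ₁ := ξ₁, ξ₂ := ξ₂, ε := ε, m := m, L := L,
      ν_pos := hν, ν_le := hνδ, ε_pos := hε, loss := hloss, data := fun i hi => (hdata i hi).1,
      minimizer := hmin, momentum := hmom, μm_pos := hμm, μ_eq := hμ, sgd := hsgd, msgd := hmsgd,
      init := hinit, init_moments := hm, risk_conditions := hrisk, noise := hnoise,
      noise_lipschitz := hlip, μ_le := hle }
  have hL0 : 0 < L := (S.μ_pos j₀).trans_le (hle j₀)
  obtain ⟨l1, l2, l3⟩ : L ≤ μ₀ ∧ L ≤ 1 ∧ L ≤ ν / 2 / (2 * δ ^ 2 + 2 * γ ^ 2 + 2 * |ξ₁|) := by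
    simpa only [le_min_iff] using hsmall
  rw [le_div_iff₀ hb] at l3
  obtain ⟨h1, h2⟩ := hC _ _ _ μ L (S.ε_le_one j₀) hL0 l1 (S.meanSquareSystem hL0.le l2 l3)
  refine ⟨fun i => ⟨S.integrable_distance i, ?_⟩, ?_⟩
  · refine (S.integral_distance_le i).trans ((h1 (i + 1)).trans ?_)
    have hpow : L ^ 2 ≤ L ^ (3 / 2 : ℝ) := by
      rw [← Real.rpow_natCast]
      exact Real.rpow_le_rpow_of_exponent_ge hL0 l2 (by norm_num)
    exact mul_le_mul (le_max_left _ _) hpow (sq_nonneg _) (le_max_right _ _)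
  · refine limsup_le_of_le ?_ ?_
    · exact isCoboundedUnder_le_of_le atTop (x := 0)
        fun i => integral_nonneg fun _ => sq_nonneg _
    -- The distance at time `i` is governed by the mean-square quantities at index `i + 1`.
    · filter_upwards [(tendsto_add_atTop_nat 1).eventually h2] with i hi
      exact (S.integral_distance_le i).trans hi
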